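/- Notation. Let $J_2=\begin{bmatrix}0&1\\-1&0\end{bmatrix}$ and $J_{2m}=J_2\oplus\cdots\oplus J_2$ ($m$ times). A G-matrix is a real symmetric positive definite $2m\times 2m$ matrix $B$ with $B+\frac{i}{2}J_{2m}\ge 0$. The symplectic eigenvalues of a real positive definite $2m\times 2m$ matrix $B$ are the positive numbers $d_1(B)\le\dots\le d_m(B)$ such that $MBM^T=d_1(B)I_2\oplus\cdots\oplus d_m(B)I_2$ for some real $M$ with $MJ_{2m}M^T=J_{2m}$ (Williamson's theorem: they exist and are unique). The von Neumann entropy of the mean zero Gaussian state with covariance matrix a G-matrix $B$ is $$S(B)=\sum_{j=1}^m\frac{2d_j(B)+1}{2}\,H\!\left(\frac{2d_j(B)-1}{2d_j(B)+1}\right),\qquad H(t)=-t\log t-(1-t)\log(1-t),\quad H(0)=H(1)=0.$$ Let $\widetilde A$ be an essentially bounded measurable function from $[-\pi,\pi]$ to the complex $2k\times 2k$ matrices, with Fourier coefficients $A_n=\frac1{2\pi}\int_{-\pi}^{\pi}\widetilde A(\theta)e^{-in\theta}\,d\theta$, $n\in\mathbb Z$. Let $T(\widetilde A)=[A_{i-j}]_{i,j\ge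 0}$, which is a bounded operator on the space $\ell^2_{2k}$ of square summable sequences in $\mathbb C^{2k}$, and for $n\ge1$ let $T_n(\widetilde A)=[A_{i-j}]_{i,j=0}^{n-1}$. Statement. Suppose that $T(\widetilde A)$ is a partially symmetric (bounded) stationary G-chain, that is, every $A_n$ is real, $A_{-n}=A_n$ for all $n\in\mathbb N$, and every $T_n(\widetilde A)$, $n\ge 1$, is a G-matrix (with respect to $J_{2nk}$). Then $\widetilde A(\theta)$ is a G-matrix for almost every $\theta\in[-\pi,\pi]$, the function $\theta\mapsto S(\widetilde A(\theta))$ is integrable on $[-\pi,\pi]$, and the entropy rate $\mathfrak S(T(\widetilde A))=\lim_{n\to\infty}\frac1n S(T_n(\widetilde A))$ of the corresponding stationary quantum Gaussian process exists and equals $$\mathfrak S(T(\widetilde A))=\frac1{2\pi}\int_{-\pi}^{\pi}S(\widetilde A(\theta))\,d\theta .$$ -/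

import Mathlib

open MeasureTheory Filter Topology
open scoped ComplexOrder

noncomputable section

namespace GaussianChain

/-- The standard symplectic matrix `J₂ ⊕ ⋯ ⊕ J₂` (one block `J₂ = [[0, 1], [-1, 0]]` per mode).
`ι` is the set of modes; the index `(i, 0)` stands for the position `q_i` and `(i, 1)` for the
momentum `p_i`. For `ι = Fin k` this is the `2k × 2k` matrix `J_{2k}`. -/
def J (ι R : Type*) [DecidableEq ι] [Ring R] : Matrix (ι × Fin 2) (ι × Fin 2) R :=
  Matrix.kroneckerMap (· * ·) (1 : Matrix ι ι R) !![0, 1; -1, 0]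

/-- Real symplectic matrices: `M J Mᵀ = J`. -/
def IsSymplectic {ι : Type*} [Fintype ι] [DecidableEq ι]
    (M : Matrix (ι × Fin 2) (ι × Fin 2) ℝ) : Prop :=
  M * J ι ℝ * M.transpose = J ι ℝ

/-- A G-matrix: a real (symmetric) positive definite matrix `A` satisfying the uncertainty
relation `A + (i/2) J ≥ 0`. -/
def IsGMatrix {ι : Type*} [Fintype ι] [DecidableEq ι]
    (A : Matrix (ι × Fin 2) (ι × Fin 2) ℝ) : Prop :=
  A.PosDef ∧ (A.map (fun x : ℝ => (x : ℂ)) + (Complex.I / 2) • J ι ℂ).PosSemidef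

/-- `d` lists the positive numbers in a Williamson normal form of `A`: for some symplectic `M`,
`M A Mᵀ = ⨁ i, d i • I₂`. -/
def IsWilliamsonSpectrum {ι : Type*} [Fintype ι] [DecidableEq ι]
    (A : Matrix (ι × Fin 2) (ι × Fin 2) ℝ) (d : ι → ℝ) : Prop :=
  (∀ i, 0 < d i) ∧
    ∃ M : Matrix (ι × Fin 2) (ι × Fin 2) ℝ, IsSymplectic M ∧
      M * A * M.transpose = Matrix.diagonal (fun p => d p.1)

open Classical in
/-- The symplectic eigenvalues of a real positive definite matrix `A`, as a family indexed by the
modes. By Williamson's theorem they exist and are unique up to order; the order is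
irrelevant below. The value `0` is used only where there is no Williamson normal form. -/
def symplecticEigenvalues {ι : Type*} [Fintype ι] [DecidableEq ι]
    (A : Matrix (ι × Fin 2) (ι × Fin 2) ℝ) : ι → ℝ :=
  if h : ∃ d, IsWilliamsonSpectrum A d then h.choose else 0

/-- The von Neumann entropy of the mean zero Gaussian state with covariance matrix `A`,
`S(A) = ∑ j, (2 d_j + 1) / 2 * H ((2 d_j - 1) / (2 d_j + 1))`, where `d_j` are the symplectic
eigenvalues of `A` and `H t = - t log t - (1 - t) log (1 - t)` is `Real.binEntropy`. -/
def entropy {ι : Type*} [Fintype ι] [DecidableEq ι]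
    (A : Matrix (ι × Fin 2) (ι × Fin 2) ℝ) : ℝ :=
  ∑ j, (2 * symplecticEigenvalues A j + 1) / 2 *
    Real.binEntropy ((2 * symplecticEigenvalues A j - 1) / (2 * symplecticEigenvalues A j + 1))

/-- The truncation `T_n = [A_{i-j}]_{i,j=0}^{n-1}` of the infinite block Toeplitz matrix
`[A_{i-j}]_{i,j≥0}`. The modes of `T_n` are the pairs (block, mode inside the block), so that
`J (Fin n × Fin k)` is the direct sum of `n` copies of `J (Fin k)`. -/
def truncation {k : ℕ} (A : ℤ → Matrix (Fin k × Fin 2) (Fin k × Fin 2) ℝ) (n : ℕ) :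
    Matrix ((Fin n × Fin k) × Fin 2) ((Fin n × Fin k) × Fin 2) ℝ :=
  Matrix.of fun p q =>
    A (((p.1.1 : ℕ) : ℤ) - ((q.1.1 : ℕ) : ℤ)) (p.1.2, p.2) (q.1.2, q.2)

/-- The infinite block Toeplitz matrix `[A_{i-j}]_{i,j≥0}` with real blocks is a (stationary)
G-chain: all its truncations are G-matrices, i.e. covariance matrices of Gaussian states. -/
def IsGChain {k : ℕ} (A : ℤ → Matrix (Fin k × Fin 2) (Fin k × Fin 2) ℝ) : Prop :=
  ∀ n : ℕ, IsGMatrix (truncation A n)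

/-- Partial symmetry of `[A_{i-j}]`: the blocks are real (here by their type) and
`A_{-n} = A_n`. -/
def IsPartiallySymmetric {k : ℕ} (A : ℤ → Matrix (Fin k × Fin 2) (Fin k × Fin 2) ℝ) : Prop :=
  ∀ n : ℕ, A (-(n : ℤ)) = A (n : ℤ)

/-- Essentially bounded (measurable) matrix functions on `[-π, π]`. They matter only up to null
sets, so nothing is required of the values at the two endpoints. -/
def MemLinfty {m : Type*} (a : ℝ → Matrix m m ℂ) : Prop :=
  ∀ i j, MemLp (fun θ => a θ i j) ⊤ (volume.restrict (Set.Icc (-Real.pi) Real.pi))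

/-- The `n`-th Fourier coefficient `(1/2π) ∫_{-π}^{π} a(θ) e^{-inθ} dθ` of a matrix function. -/
def fourierBlock {m : Type*} (a : ℝ → Matrix m m ℂ) (n : ℤ) : Matrix m m ℂ :=
  Matrix.of fun i j =>
    1 / (2 * (Real.pi : ℂ)) *
      ∫ θ in (-Real.pi)..Real.pi, a θ i j * Complex.exp (-Complex.I * (n : ℂ) * (θ : ℂ))

/-- The block Toeplitz matrix `[A_{i-j}]_{i,j≥0}` is generated by the symbol `a` in `L^∞`: its
blocks are the Fourier coefficients of `a`. (Such a matrix is a bounded operator on the space of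
square summable sequences, and every bounded block Toeplitz matrix has such a symbol.) -/
def IsGeneratedBy {k : ℕ} (A : ℤ → Matrix (Fin k × Fin 2) (Fin k × Fin 2) ℝ)
    (a : ℝ → Matrix (Fin k × Fin 2) (Fin k × Fin 2) ℂ) : Prop :=
  MemLinfty a ∧ ∀ n : ℤ, fourierBlock a n = (A n).map (fun x : ℝ => (x : ℂ))

/-- `s` is the entropy rate of the stationary Gaussian process of the G-chain `[A_{i-j}]`:
`S(T_n) / n → s`. -/
def HasEntropyRate {k : ℕ} (A : ℤ → Matrix (Fin k × Fin 2) (Fin k × Fin 2) ℝ) (s : ℝ) : Prop :=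
  Tendsto (fun n : ℕ => entropy (truncation A n) / (n : ℝ)) atTop (𝓝 s)

/-- The entrywise real part of a complex matrix; used only for matrices with real entries. -/
def realPart {m : Type*} (B : Matrix m m ℂ) : Matrix m m ℝ := B.map Complex.re

end GaussianChain

end

/-!
# The entropy rate of a partially symmetric stationary Gaussian chain

The symplectic eigenvalues `d_j` of a positive definite `A` are visible in the matrix `J A`, which
is similar to `⨁ d_j J₂` (`trace_J_mul_pow`): hence `½ tr p(-(J A)²) = ∑ p(d_j²)` for every
polynomial `p`. The entropy is `∑ φ(d_j²)` with a continuous `φ`, and the `d_j²` are bounded in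
terms of the operator norm of `A`, so by Weierstrass approximation it suffices to know the limits
of the normalized traces of the powers of `J T_n(a)`. As `J` acts blockwise, `J T_n(a) = T_n(J a)`
is again a block Toeplitz matrix, with the essentially bounded, non-Hermitian symbol `J a`.

For such a symbol `b`, `(1/n) tr T_n(b)^s` tends to the mean of `tr b^s`
(`tendsto_trace_blockToeplitz_pow`). This follows by induction on `s` from the fact that
`T_n(f) T_n(g) - T_n(f g)` is `o(√n)` in Hilbert-Schmidt norm (`tendsto_toeplitz_mul_sub`): column
`j` of this matrix consists of Fourier coefficients of `f` times the part of `e_j g` with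
frequencies outside `[0, n)`, and the mean square of that part is a tail of Parseval's series for
`g`, small unless `j` is close to `0` or `n`.

The symbol is real almost everywhere because its Fourier coefficients are real and symmetric in
`n`, and `a + (i/2) J` is positive semidefinite almost everywhere because its block Toeplitz
matrices are and trigonometric polynomials are dense in `L²` (`ae_posSemidef_of_blockToeplitz`).
Existence of the Williamson normal form is derived from the normal form of a real skew-symmetric
operator (`exists_isWilliamsonSpectrum`).
-/

noncomputable section

namespace GaussianChain

open AddCircle

/-! ### Scalar Toeplitz matrices -/

section

variable {T : ℝ} [hT : Fact (0 < T)]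

/-- The trigonometric polynomial `∑ j < n, x j e_j` on the circle. -/
def trigPoly {n : ℕ} (x : Fin n → ℂ) (t : AddCircle T) : ℂ :=
  ∑ j : Fin n, x j * fourier (j : ℤ) t

/-- The `n × n` Toeplitz matrix `[f̂(i - j)]` of a scalar symbol on the circle. -/
def toeplitz (f : AddCircle T → ℂ) (n : ℕ) : Matrix (Fin n) (Fin n) ℂ :=
  Matrix.of fun i j => fourierCoeff f ((i : ℤ) - (j : ℤ))

omit hT in
theorem continuous_trigPoly {n : ℕ} (x : Fin n → ℂ) :
    Continuous (trigPoly x : AddCircle T → ℂ) := by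
  unfold trigPoly
  fun_prop

theorem memLp_top_of_continuous {f : AddCircle T → ℂ} (hf : Continuous f) :
    MemLp f ⊤ (haarAddCircle (T := T)) := by
  obtain ⟨C, hC⟩ := isCompact_univ.exists_bound_of_continuousOn hf.continuousOn
  exact memLp_top_of_bound hf.aestronglyMeasurable C (ae_of_all _ fun t => hC t (Set.mem_univ t))

theorem exists_ae_norm_le {f : AddCircle T → ℂ} (hf : MemLp f ⊤ (haarAddCircle (T := T))) :
    ∃ C : ℝ, ∀ᵐ t ∂(haarAddCircle (T := T)), ‖f t‖ ≤ C := by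
  refine ⟨(eLpNorm f ⊤ haarAddCircle).toReal, ?_⟩
  filter_upwards [ae_le_eLpNormEssSup (f := f) (μ := haarAddCircle)] with t ht
  have := ENNReal.toReal_mono hf.2.ne (ht.trans_eq eLpNorm_exponent_top.symm)
  simpa using this

theorem fourierCoeff_mul_fourier (f : AddCircle T → ℂ) (j i : ℤ) :
    fourierCoeff (fun t => f t * fourier j t) i = fourierCoeff f (i - j) := by
  unfold fourierCoeff
  congr 1
  ext t
  rw [show -(i - j) = -i + j by ring, fourier_add]
  simp only [smul_eq_mul]
  ring

theorem fourierCoeff_finsetSum {ι : Type*} (s : Finset ι) (f : ι → AddCircle T → ℂ)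
    (hf : ∀ i ∈ s, MemLp (f i) ⊤ (haarAddCircle (T := T))) (n : ℤ) :
    fourierCoeff (fun t => ∑ i ∈ s, f i t) n = ∑ i ∈ s, fourierCoeff (f i) n := by
  have := congrFun (fourierCoeff.sum s f fun i hi => (hf i hi).integrable le_top) n
  rw [Finset.sum_apply] at this
  rw [← this]
  congr 1
  ext t
  simp

theorem fourierCoeff_mul_trigPoly {f : AddCircle T → ℂ}
    (hf : MemLp f ⊤ (haarAddCircle (T := T))) {n : ℕ} (x : Fin n → ℂ) (i : ℤ) :
    fourierCoeff (fun t => f t * trigPoly x t) i =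
      ∑ j : Fin n, fourierCoeff f (i - (j : ℤ)) * x j := by
  have h : (fun t => f t * trigPoly x t) =
      fun t => ∑ j : Fin n, x j * (f t * fourier (j : ℤ) t) := by
    ext t
    rw [trigPoly, Finset.mul_sum]
    exact Finset.sum_congr rfl fun j _ => by ring
  rw [h, fourierCoeff_finsetSum]
  · refine Finset.sum_congr rfl fun j _ => ?_
    rw [fourierCoeff.const_mul, fourierCoeff_mul_fourier, mul_comm]
  · intro j _
    exact ((memLp_top_of_continuous (map_continuous (fourier (j : ℤ)))).mul' hf).const_mul _

theorem hasSum_sq_fourierCoeff_of_memLp {f : AddCircle T → ℂ}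
    (hf : MemLp f 2 (haarAddCircle (T := T))) :
    HasSum (fun i => ‖fourierCoeff f i‖ ^ 2) (∫ t, ‖f t‖ ^ 2 ∂haarAddCircle) := by
  convert hasSum_sq_fourierCoeff hf.toLp using 1
  · rw [fourierCoeff_congr_ae hf.coeFn_toLp]
  · refine integral_congr_ae ?_
    filter_upwards [hf.coeFn_toLp] with x hx
    rw [hx]

/-- The embedding of `{0, …, n - 1}` into the integers. -/
def finToInt (n : ℕ) : Fin n ↪ ℤ :=
  ⟨fun i => (i : ℤ), fun _ _ h => Fin.ext (Int.ofNat.inj h)⟩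

@[simp] theorem finToInt_apply {n : ℕ} (i : Fin n) : finToInt n i = (i : ℤ) := rfl

/-- Bessel's inequality. -/
theorem sum_sq_fourierCoeff_le {f : AddCircle T → ℂ}
    (hf : MemLp f 2 (haarAddCircle (T := T))) (n : ℕ) :
    ∑ i : Fin n, ‖fourierCoeff f (i : ℤ)‖ ^ 2 ≤ ∫ t, ‖f t‖ ^ 2 ∂haarAddCircle := by
  have := sum_le_hasSum (Finset.univ.map (finToInt n)) (fun i _ => sq_nonneg _)
    (hasSum_sq_fourierCoeff_of_memLp hf)
  simpa using this

theorem fourierCoeff_one (i : ℤ) :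
    fourierCoeff (fun _ : AddCircle T => (1 : ℂ)) i = if i = 0 then 1 else 0 := by
  have h := fourierCoeff_fourier (T := T) 0
  have h' : (fun _ : AddCircle T => (1 : ℂ)) = fourier 0 := by
    ext t; simp
  rw [h', h, Pi.single_apply]

theorem fourierCoeff_trigPoly {n : ℕ} (x : Fin n → ℂ) (i : ℤ) :
    fourierCoeff (trigPoly x : AddCircle T → ℂ) i = ∑ j : Fin n, if i = (j : ℤ) then x j else 0 := by
  have := fourierCoeff_mul_trigPoly (T := T) (f := fun _ => 1)
    (memLp_top_of_continuous continuous_const) x i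
  simpa [fourierCoeff_one, sub_eq_zero] using this

theorem integral_sq_trigPoly {n : ℕ} (x : Fin n → ℂ) :
    ∫ t, ‖(trigPoly x : AddCircle T → ℂ) t‖ ^ 2 ∂haarAddCircle = ∑ j, ‖x j‖ ^ 2 := by
  have h2 : MemLp (trigPoly x : AddCircle T → ℂ) 2 haarAddCircle :=
    (memLp_top_of_continuous (continuous_trigPoly x)).mono_exponent le_top
  refine (hasSum_sq_fourierCoeff_of_memLp h2).unique ?_
  have h := hasSum_sum_of_ne_finset_zero (f := fun i => ‖fourierCoeff (trigPoly x : AddCircle T → ℂ) i‖ ^ 2)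
    (s := Finset.univ.map (finToInt n)) (L := .unconditional ℤ) (by
      intro i hi
      rw [fourierCoeff_trigPoly, Finset.sum_eq_zero]
      · simp
      · intro j _
        rw [if_neg]
        rintro rfl
        exact hi (by simp))
  convert h using 1
  simp [fourierCoeff_trigPoly, Fin.val_inj]

theorem integral_sq_mul_le {f h : AddCircle T → ℂ} {C : ℝ}
    (hf : MemLp f ⊤ (haarAddCircle (T := T)))
    (hC : ∀ᵐ t ∂(haarAddCircle (T := T)), ‖f t‖ ≤ C) (hh : MemLp h 2 (haarAddCircle (T := T))) :
    ∫ t, ‖f t * h t‖ ^ 2 ∂haarAddCircle ≤ C ^ 2 * ∫ t, ‖h t‖ ^ 2 ∂haarAddCircle := by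
  rw [← integral_const_mul]
  refine integral_mono_ae ((hh.mul' hf : MemLp _ 2 _).integrable_norm_pow two_ne_zero)
    ((hh.integrable_norm_pow two_ne_zero).const_mul _) ?_
  filter_upwards [hC] with t ht
  simp only [norm_mul, mul_pow]
  gcongr

/-- `‖T_n(f)‖ ≤ ‖f‖_∞`. -/
theorem sum_sq_toeplitz_mulVec_le {f : AddCircle T → ℂ} {C : ℝ}
    (hf : MemLp f ⊤ (haarAddCircle (T := T)))
    (hC : ∀ᵐ t ∂(haarAddCircle (T := T)), ‖f t‖ ≤ C) {n : ℕ} (x : Fin n → ℂ) :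
    ∑ i, ‖(toeplitz f n).mulVec x i‖ ^ 2 ≤ C ^ 2 * ∑ j, ‖x j‖ ^ 2 := by
  have hp : MemLp (trigPoly x : AddCircle T → ℂ) 2 haarAddCircle :=
    (memLp_top_of_continuous (continuous_trigPoly x)).mono_exponent le_top
  rw [← integral_sq_trigPoly (T := T) x]
  refine le_trans (le_of_eq ?_) ((sum_sq_fourierCoeff_le
    (hp.mul' hf : MemLp (fun t => f t * trigPoly x t) 2 _) n).trans (integral_sq_mul_le hf hC hp))
  simp [fourierCoeff_mul_trigPoly hf, Matrix.mulVec, dotProduct, toeplitz]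

/-- Column `j` of `T_n(f) T_n(g) - T_n(f g)` consists of Fourier coefficients of `f` times the
projection of `-e_j g` to the frequencies outside `[0, n)`, whose mean square is the bracket on the
right-hand side. -/
theorem sum_sq_toeplitz_mul_sub_le {f g : AddCircle T → ℂ} {C : ℝ}
    (hf : MemLp f ⊤ (haarAddCircle (T := T))) (hg : MemLp g ⊤ (haarAddCircle (T := T)))
    (hC : ∀ᵐ t ∂(haarAddCircle (T := T)), ‖f t‖ ≤ C) {n : ℕ} (j : Fin n) :
    ∑ i, ‖(toeplitz f n * toeplitz g n - toeplitz (fun t => f t * g t) n) i j‖ ^ 2 ≤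
      C ^ 2 * (∫ t, ‖g t‖ ^ 2 ∂haarAddCircle -
        ∑ l : Fin n, ‖fourierCoeff g ((l : ℤ) - (j : ℤ))‖ ^ 2) := by
  set y : Fin n → ℂ := fun l => fourierCoeff g ((l : ℤ) - (j : ℤ)) with hy
  set h : AddCircle T → ℂ := fun t => trigPoly y t - g t * fourier (j : ℤ) t with hh
  have hp := memLp_top_of_continuous (continuous_trigPoly (T := T) y)
  have hgj : MemLp (fun t => g t * fourier (j : ℤ) t) ⊤ (haarAddCircle (T := T)) :=
    (memLp_top_of_continuous (map_continuous (fourier (j : ℤ)))).mul' hg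
  have hmem : MemLp h ⊤ (haarAddCircle (T := T)) := hp.sub hgj
  have hmem2 : MemLp h 2 (haarAddCircle (T := T)) := hmem.mono_exponent le_top
  have hcoeff : ∀ i : ℤ, fourierCoeff h i =
      (∑ l : Fin n, if i = (l : ℤ) then y l else 0) - fourierCoeff g (i - j) := by
    intro i
    rw [← fourierCoeff_trigPoly (T := T), ← fourierCoeff_mul_fourier]
    simp only [fourierCoeff, ← integral_sub (((hp.integrable le_top)).fourier_smul _)
      (((hgj.integrable le_top)).fourier_smul _), ← smul_sub, hh]
  have hnorm : ∫ t, ‖h t‖ ^ 2 ∂haarAddCircle =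
      ∫ t, ‖g t‖ ^ 2 ∂haarAddCircle - ∑ l : Fin n, ‖fourierCoeff g ((l : ℤ) - (j : ℤ))‖ ^ 2 := by
    refine (hasSum_sq_fourierCoeff_of_memLp hmem2).unique ?_
    have h1 : HasSum (fun i : ℤ => ‖fourierCoeff g (i - (j : ℤ))‖ ^ 2)
        (∫ t, ‖g t‖ ^ 2 ∂haarAddCircle) :=
      (Equiv.subRight (j : ℤ)).hasSum_iff.2
        (hasSum_sq_fourierCoeff_of_memLp (hg.mono_exponent le_top))
    have h2 := hasSum_sum_of_ne_finset_zero
      (f := fun i : ℤ => if i ∈ Finset.univ.map (finToInt n) then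
        ‖fourierCoeff g (i - (j : ℤ))‖ ^ 2 else 0)
      (s := Finset.univ.map (finToInt n)) (L := .unconditional ℤ) (fun i hi => if_neg hi)
    rw [Finset.sum_congr rfl fun i hi => if_pos hi, Finset.sum_map] at h2
    have e : ∀ i : ℤ, ‖fourierCoeff h i‖ ^ 2 = ‖fourierCoeff g (i - (j : ℤ))‖ ^ 2 -
        if i ∈ Finset.univ.map (finToInt n) then ‖fourierCoeff g (i - (j : ℤ))‖ ^ 2 else 0 := by
      intro i
      rw [hcoeff]
      by_cases hi : i ∈ Finset.univ.map (finToInt n)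
      · rw [if_pos hi]
        obtain ⟨l, -, rfl⟩ := Finset.mem_map.1 hi
        simp [Fin.val_inj, hy]
      · rw [if_neg hi, Finset.sum_eq_zero]
        · simp
        · intro l _
          rw [if_neg]
          rintro rfl
          exact hi (by simp)
    rw [funext e]
    exact h1.sub h2
  rw [← hnorm]
  refine le_trans (le_of_eq ?_) ((sum_sq_fourierCoeff_le
    (hmem2.mul' hf : MemLp (fun t => f t * h t) 2 _) n).trans (integral_sq_mul_le hf hC hmem2))
  refine Finset.sum_congr rfl fun i _ => ?_
  congr 2
  have h1 : fourierCoeff (fun t => f t * h t) (i : ℤ) =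
      fourierCoeff (fun t => f t * trigPoly y t) (i : ℤ) -
      fourierCoeff (fun t => (f t * g t) * fourier (j : ℤ) t) (i : ℤ) := by
    have e1 : MemLp (fun t => f t * trigPoly y t) ⊤ (haarAddCircle (T := T)) := hp.mul' hf
    have e2 : MemLp (fun t => f t * g t * fourier (j : ℤ) t) ⊤ (haarAddCircle (T := T)) := by
      simpa only [mul_assoc] using (hgj.mul' hf : MemLp _ ⊤ _)
    simp only [fourierCoeff, ← integral_sub (((e1.integrable le_top)).fourier_smul _)
      (((e2.integrable le_top)).fourier_smul _), ← smul_sub, hh]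
    congr 1
    ext t
    simp only [smul_eq_mul]
    ring
  rw [h1, fourierCoeff_mul_trigPoly hf, fourierCoeff_mul_fourier]
  simp [Matrix.mul_apply, toeplitz, hy]

/-- The part of Parseval's series `∑ |ĝ(m)|²` outside `[-N, N]`. -/
def parsevalTail (g : AddCircle T → ℂ) (N : ℕ) : ℝ :=
  ∫ t, ‖g t‖ ^ 2 ∂haarAddCircle - ∑ m ∈ Finset.Icc (-(N : ℤ)) N, ‖fourierCoeff g m‖ ^ 2

theorem tendsto_parsevalTail {g : AddCircle T → ℂ} (hg : MemLp g 2 (haarAddCircle (T := T))) :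
    Tendsto (parsevalTail g) atTop (𝓝 0) := by
  have h1 : Tendsto (fun N : ℕ => Finset.Icc (-(N : ℤ)) N) atTop atTop := by
    refine tendsto_atTop_finset_of_monotone ?_ ?_
    · intro a b hab
      exact Finset.Icc_subset_Icc (by omega) (by omega)
    · intro x
      exact ⟨x.natAbs, Finset.mem_Icc.2 (by omega)⟩
  have h2 := (hasSum_sq_fourierCoeff_of_memLp hg).comp h1
  have h3 := h2.const_sub (∫ t, ‖g t‖ ^ 2 ∂haarAddCircle)
  rw [sub_self] at h3
  exact h3

theorem parsevalTail_nonneg {g : AddCircle T → ℂ} (hg : MemLp g 2 (haarAddCircle (T := T)))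
    (N : ℕ) : 0 ≤ parsevalTail g N :=
  sub_nonneg.2 (sum_le_hasSum _ (fun _ _ => sq_nonneg _) (hasSum_sq_fourierCoeff_of_memLp hg))

theorem parseval_defect_le {g : AddCircle T → ℂ} (hg : MemLp g 2 (haarAddCircle (T := T)))
    {n : ℕ} (j : Fin n) :
    ∫ t, ‖g t‖ ^ 2 ∂haarAddCircle - ∑ l : Fin n, ‖fourierCoeff g ((l : ℤ) - (j : ℤ))‖ ^ 2 ≤
      parsevalTail g j + parsevalTail g (n - 1 - j) := by
  -- the window `[-j, n - 1 - j]` contains the symmetric one of half-width `min j (n - 1 - j)`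
  have key : ∀ N : ℕ, N ≤ j → N ≤ n - 1 - j →
      ∫ t, ‖g t‖ ^ 2 ∂haarAddCircle - ∑ l : Fin n, ‖fourierCoeff g ((l : ℤ) - (j : ℤ))‖ ^ 2 ≤
      parsevalTail g N := by
    intro N h1 h2
    refine sub_le_sub_left ?_ _
    have e : ∑ l : Fin n, ‖fourierCoeff g ((l : ℤ) - (j : ℤ))‖ ^ 2 =
        ∑ m ∈ Finset.univ.map ((finToInt n).trans (Equiv.subRight (j : ℤ)).toEmbedding),
          ‖fourierCoeff g m‖ ^ 2 := by
      rw [Finset.sum_map]; simp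
    rw [e]
    refine Finset.sum_le_sum_of_subset_of_nonneg ?_ fun _ _ _ => sq_nonneg _
    intro m hm
    rw [Finset.mem_Icc] at hm
    have hj := j.2
    refine Finset.mem_map.2 ⟨⟨(m + j).toNat, by omega⟩, Finset.mem_univ _, ?_⟩
    simp
    omega
  have p1 := parsevalTail_nonneg hg j
  have p2 := parsevalTail_nonneg hg (n - 1 - j)
  rcases le_total (j : ℕ) (n - 1 - j) with h | h
  · have := key j le_rfl h
    linarith
  · have := key (n - 1 - j) h le_rfl
    linarith

/-- `T_n(f) T_n(g) - T_n(f g)` tends to zero in the normalized Hilbert-Schmidt norm: the Parseval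
tails that bound its columns tend to zero, hence so do their Cesàro means. -/
theorem tendsto_toeplitz_mul_sub {f g : AddCircle T → ℂ}
    (hf : MemLp f ⊤ (haarAddCircle (T := T))) (hg : MemLp g ⊤ (haarAddCircle (T := T))) :
    Tendsto (fun n : ℕ => (∑ i, ∑ j, ‖(toeplitz f n * toeplitz g n -
      toeplitz (fun t => f t * g t) n) i j‖ ^ 2) / (n : ℝ)) atTop (𝓝 0) := by
  obtain ⟨C, hC⟩ : ∃ C : ℝ, ∀ᵐ t ∂(haarAddCircle (T := T)), ‖f t‖ ≤ C :=
    exists_ae_norm_le hf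
  have hg2 : MemLp g 2 (haarAddCircle (T := T)) := hg.mono_exponent le_top
  have hces := ((tendsto_parsevalTail hg2).cesaro.const_mul (2 * C ^ 2))
  rw [mul_zero] at hces
  refine squeeze_zero (fun n => by positivity) (fun n => ?_) hces
  rw [Finset.sum_comm]
  have h1 : ∑ j : Fin n, ∑ i, ‖(toeplitz f n * toeplitz g n -
      toeplitz (fun t => f t * g t) n) i j‖ ^ 2 ≤
      ∑ j : Fin n, C ^ 2 * (parsevalTail g j + parsevalTail g (n - 1 - j)) :=
    Finset.sum_le_sum fun j _ => (sum_sq_toeplitz_mul_sub_le hf hg hC j).trans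
      (mul_le_mul_of_nonneg_left (parseval_defect_le hg2 j) (sq_nonneg C))
  have h2 : ∑ j : Fin n, C ^ 2 * (parsevalTail g j + parsevalTail g (n - 1 - j)) =
      2 * C ^ 2 * ∑ i ∈ Finset.range n, parsevalTail g i := by
    rw [← Finset.mul_sum,
      Fin.sum_univ_eq_sum_range (fun j => parsevalTail g j + parsevalTail g (n - 1 - j)),
      Finset.sum_add_distrib, Finset.sum_range_reflect (parsevalTail g)]
    ring
  rw [h2] at h1
  calc _ ≤ (2 * C ^ 2 * ∑ i ∈ Finset.range n, parsevalTail g i) / n := by gcongr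
    _ = _ := by ring

end

/-! ### Block Toeplitz matrices and traces of their powers -/

section

variable {T : ℝ} [hT : Fact (0 < T)] {m : Type*}

/-- Essentially bounded matrix symbols on the circle. -/
def IsBddSymbol (α : AddCircle T → Matrix m m ℂ) : Prop :=
  ∀ a b, MemLp (fun t => α t a b) ⊤ (haarAddCircle (T := T))

/-- The block Toeplitz matrix `T_n(α) = [α̂(i - j)]_{i, j < n}` of a matrix symbol. -/
def blockToeplitz (α : AddCircle T → Matrix m m ℂ) (n : ℕ) :
    Matrix (Fin n × m) (Fin n × m) ℂ :=
  Matrix.of fun p q => fourierCoeff (fun t => α t p.2 q.2) ((p.1 : ℤ) - (q.1 : ℤ))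

/-- The square of the Frobenius (Hilbert-Schmidt) norm. -/
def frobSq {κ : Type*} [Fintype κ] (X : Matrix κ κ ℂ) : ℝ := ∑ q, ∑ p, ‖X p q‖ ^ 2

theorem frobSq_nonneg {κ : Type*} [Fintype κ] (X : Matrix κ κ ℂ) : 0 ≤ frobSq X :=
  Finset.sum_nonneg fun _ _ => Finset.sum_nonneg fun _ _ => sq_nonneg _

theorem norm_sum_sq_le {κ : Type*} (s : Finset κ) (y : κ → ℂ) :
    ‖∑ b ∈ s, y b‖ ^ 2 ≤ s.card * ∑ b ∈ s, ‖y b‖ ^ 2 :=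
  (pow_le_pow_left₀ (norm_nonneg _) (norm_sum_le s y) 2).trans sq_sum_le_card_mul_sum_sq

theorem frobSq_add_le {κ : Type*} [Fintype κ] (X Y : Matrix κ κ ℂ) :
    frobSq (X + Y) ≤ 2 * frobSq X + 2 * frobSq Y := by
  simp only [frobSq, Finset.mul_sum, ← Finset.sum_add_distrib]
  refine Finset.sum_le_sum fun q _ => Finset.sum_le_sum fun p _ => ?_
  have h1 : ‖(X + Y) p q‖ ≤ ‖X p q‖ + ‖Y p q‖ := norm_add_le _ _
  nlinarith [norm_nonneg ((X + Y) p q), sq_nonneg (‖X p q‖ - ‖Y p q‖)]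

theorem norm_trace_sq_le {κ : Type*} [Fintype κ] (X : Matrix κ κ ℂ) :
    ‖X.trace‖ ^ 2 ≤ Fintype.card κ * frobSq X := by
  refine (norm_sum_sq_le Finset.univ fun p => X p p).trans ?_
  rw [Finset.card_univ]
  refine mul_le_mul_of_nonneg_left (Finset.sum_le_sum fun q _ => ?_) (by positivity)
  exact Finset.single_le_sum (f := fun p => ‖X p q‖ ^ 2) (fun _ _ => sq_nonneg _)
    (Finset.mem_univ q)

section

variable [Fintype m]

theorem IsBddSymbol.mul {α β : AddCircle T → Matrix m m ℂ} (hα : IsBddSymbol α)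
    (hβ : IsBddSymbol β) : IsBddSymbol fun t => α t * β t := by
  intro a b
  simp only [Matrix.mul_apply]
  exact memLp_finsetSum _ fun c _ => (hβ c b).mul' (hα a c)

omit [Fintype m] in
theorem isBddSymbol_const (M : Matrix m m ℂ) : IsBddSymbol fun _ : AddCircle T => M :=
  fun a b => memLp_top_of_continuous (f := fun _ => M a b) continuous_const

theorem IsBddSymbol.pow [DecidableEq m] {α : AddCircle T → Matrix m m ℂ} (hα : IsBddSymbol α)
    (s : ℕ) : IsBddSymbol fun t => α t ^ s := by
  induction s with
  | zero => simpa using isBddSymbol_const (T := T) (1 : Matrix m m ℂ)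
  | succ s ih => simpa only [pow_succ'] using hα.mul ih

theorem blockToeplitz_mulVec (α : AddCircle T → Matrix m m ℂ) (n : ℕ) (x : Fin n × m → ℂ)
    (p : Fin n × m) : (blockToeplitz α n).mulVec x p =
      ∑ b, (toeplitz (fun t => α t p.2 b) n).mulVec (fun j => x (j, b)) p.1 := by
  simp only [Matrix.mulVec, dotProduct, blockToeplitz, toeplitz, Matrix.of_apply,
    Fintype.sum_prod_type_right]

/-- The matrices `T_n(α)` are bounded uniformly in `n`. -/
theorem exists_sum_sq_blockToeplitz_mulVec_le {α : AddCircle T → Matrix m m ℂ}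
    (hα : IsBddSymbol α) : ∃ D : ℝ, 0 ≤ D ∧ ∀ (n : ℕ) (x : Fin n × m → ℂ),
      ∑ p, ‖(blockToeplitz α n).mulVec x p‖ ^ 2 ≤ D * ∑ p, ‖x p‖ ^ 2 := by
  choose C hC using fun a b => exists_ae_norm_le (hα a b)
  refine ⟨∑ a, ∑ b, Fintype.card m * C a b ^ 2, by positivity, fun n x => ?_⟩
  rw [Fintype.sum_prod_type_right, Finset.sum_mul]
  refine Finset.sum_le_sum fun a _ => ?_
  calc ∑ i, ‖(blockToeplitz α n).mulVec x (i, a)‖ ^ 2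
      ≤ ∑ i, Fintype.card m *
          ∑ b, ‖(toeplitz (fun t => α t a b) n).mulVec (fun j => x (j, b)) i‖ ^ 2 := by
        refine Finset.sum_le_sum fun i _ => ?_
        rw [blockToeplitz_mulVec]
        exact norm_sum_sq_le _ _
    _ = ∑ b, Fintype.card m *
          ∑ i, ‖(toeplitz (fun t => α t a b) n).mulVec (fun j => x (j, b)) i‖ ^ 2 := by
        rw [← Finset.mul_sum, Finset.sum_comm, Finset.mul_sum]
    _ ≤ ∑ b, Fintype.card m * (C a b ^ 2 * ∑ p, ‖x p‖ ^ 2) := by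
        refine Finset.sum_le_sum fun b _ => mul_le_mul_of_nonneg_left ?_ (by positivity)
        refine (sum_sq_toeplitz_mulVec_le (hα a b) (hC a b) _).trans
          (mul_le_mul_of_nonneg_left ?_ (sq_nonneg _))
        rw [Fintype.sum_prod_type_right]
        exact Finset.single_le_sum (f := fun b => ∑ j, ‖x (j, b)‖ ^ 2)
          (fun _ _ => Finset.sum_nonneg fun _ _ => sq_nonneg _) (Finset.mem_univ b)
    _ = _ := by
        rw [Finset.sum_mul]
        exact Finset.sum_congr rfl fun b _ => by ring

theorem exists_frobSq_blockToeplitz_mul_le {α : AddCircle T → Matrix m m ℂ}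
    (hα : IsBddSymbol α) : ∃ D : ℝ, 0 ≤ D ∧ ∀ (n : ℕ) (X : Matrix (Fin n × m) (Fin n × m) ℂ),
      frobSq (blockToeplitz α n * X) ≤ D * frobSq X := by
  obtain ⟨D, hD0, hD⟩ := exists_sum_sq_blockToeplitz_mulVec_le hα
  refine ⟨D, hD0, fun n X => ?_⟩
  rw [frobSq, frobSq, Finset.mul_sum]
  exact Finset.sum_le_sum fun q _ => hD n fun p => X p q

theorem blockToeplitz_mul_sub_apply {α β : AddCircle T → Matrix m m ℂ} (hα : IsBddSymbol α)
    (hβ : IsBddSymbol β) (n : ℕ) (p q : Fin n × m) :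
    (blockToeplitz α n * blockToeplitz β n - blockToeplitz (fun t => α t * β t) n) p q =
      ∑ b, (toeplitz (fun t => α t p.2 b) n * toeplitz (fun t => β t b q.2) n -
        toeplitz (fun t => α t p.2 b * β t b q.2) n) p.1 q.1 := by
  simp only [Matrix.sub_apply, Finset.sum_sub_distrib, Matrix.mul_apply, blockToeplitz, toeplitz,
    Matrix.of_apply, Fintype.sum_prod_type_right]
  rw [fourierCoeff_finsetSum _ (fun b t => α t p.2 b * β t b q.2)
    fun b _ => (hβ b q.2).mul' (hα p.2 b)]

theorem tendsto_frobSq_blockToeplitz_mul_sub {α β : AddCircle T → Matrix m m ℂ}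
    (hα : IsBddSymbol α) (hβ : IsBddSymbol β) :
    Tendsto (fun n : ℕ => frobSq (blockToeplitz α n * blockToeplitz β n -
      blockToeplitz (fun t => α t * β t) n) / (n : ℝ)) atTop (𝓝 0) := by
  have hlim := tendsto_finsetSum (Finset.univ : Finset m) fun a _ =>
    tendsto_finsetSum (Finset.univ : Finset m) fun c _ =>
      (tendsto_finsetSum (Finset.univ : Finset m) fun b _ =>
        tendsto_toeplitz_mul_sub (hα a b) (hβ b c)).const_mul (Fintype.card m : ℝ)
  simp only [Finset.sum_const_zero, mul_zero] at hlim
  refine squeeze_zero (fun n => div_nonneg (frobSq_nonneg _) n.cast_nonneg) (fun n => ?_) hlim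
  simp only [← Finset.sum_div, ← mul_div_assoc]
  refine div_le_div_of_nonneg_right ?_ n.cast_nonneg
  calc frobSq _ ≤ ∑ q : Fin n × m, ∑ p : Fin n × m, Fintype.card m *
        ∑ b, ‖(toeplitz (fun t => α t p.2 b) n * toeplitz (fun t => β t b q.2) n -
        toeplitz (fun t => α t p.2 b * β t b q.2) n) p.1 q.1‖ ^ 2 := by
        refine Finset.sum_le_sum fun q _ => Finset.sum_le_sum fun p _ => ?_
        rw [blockToeplitz_mul_sub_apply hα hβ]
        exact norm_sum_sq_le _ _
    _ = _ := by
        rw [Finset.sum_comm, Fintype.sum_prod_type_right]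
        refine Finset.sum_congr rfl fun a _ => ?_
        simp only [Fintype.sum_prod_type_right]
        rw [Finset.sum_comm]
        refine Finset.sum_congr rfl fun c _ => ?_
        simp only [← Finset.mul_sum]
        congr 1
        rw [Finset.sum_comm]
        simp only [Finset.sum_comm (s := (Finset.univ : Finset (Fin n)))
          (t := (Finset.univ : Finset m))]
        refine Finset.sum_congr rfl fun b _ => ?_
        rw [Finset.sum_comm]

variable [DecidableEq m]

omit [Fintype m] in
theorem blockToeplitz_one (n : ℕ) :
    blockToeplitz (fun _ : AddCircle T => (1 : Matrix m m ℂ)) n = 1 := by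
  ext p q
  have h : ∀ c : ℂ, (fun _ : AddCircle T => c) = fun t => c * (fun _ => (1 : ℂ)) t := by
    intro c; simp
  rw [blockToeplitz, Matrix.of_apply, h, fourierCoeff.const_mul, fourierCoeff_one]
  by_cases h1 : p.1 = q.1 <;> by_cases h2 : p.2 = q.2 <;>
    simp [Matrix.one_apply, Prod.ext_iff, h1, h2, sub_eq_zero, Fin.val_inj]

theorem tendsto_frobSq_blockToeplitz_pow_sub {α : AddCircle T → Matrix m m ℂ}
    (hα : IsBddSymbol α) (s : ℕ) :
    Tendsto (fun n : ℕ => frobSq (blockToeplitz α n ^ s - blockToeplitz (fun t => α t ^ s) n) /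
      (n : ℝ)) atTop (𝓝 0) := by
  induction s with
  | zero => simp [blockToeplitz_one, frobSq]
  | succ s ih =>
    obtain ⟨D, hD0, hD⟩ := exists_frobSq_blockToeplitz_mul_le hα
    have hlim := (ih.const_mul (2 * D)).add
      ((tendsto_frobSq_blockToeplitz_mul_sub hα (hα.pow s)).const_mul 2)
    rw [mul_zero, mul_zero, add_zero] at hlim
    refine squeeze_zero (fun n => div_nonneg (frobSq_nonneg _) n.cast_nonneg) (fun n => ?_) hlim
    simp only [← mul_div_assoc, ← add_div]
    refine div_le_div_of_nonneg_right ?_ n.cast_nonneg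
    have e : blockToeplitz α n ^ (s + 1) - blockToeplitz (fun t => α t ^ (s + 1)) n =
        blockToeplitz α n * (blockToeplitz α n ^ s - blockToeplitz (fun t => α t ^ s) n) +
        (blockToeplitz α n * blockToeplitz (fun t => α t ^ s) n -
          blockToeplitz (fun t => α t * α t ^ s) n) := by
      simp only [pow_succ', mul_sub]
      abel
    rw [e]
    refine (frobSq_add_le _ _).trans ?_
    have := hD n (blockToeplitz α n ^ s - blockToeplitz (fun t => α t ^ s) n)
    linarith

omit [DecidableEq m] in
theorem trace_blockToeplitz {α : AddCircle T → Matrix m m ℂ} (hα : IsBddSymbol α) (n : ℕ) :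
    (blockToeplitz α n).trace = n * ∫ t, (α t).trace ∂haarAddCircle := by
  have h : ∫ t, (α t).trace ∂haarAddCircle = ∑ a, ∫ t, α t a a ∂haarAddCircle := by
    simp only [Matrix.trace, Matrix.diag]
    exact integral_finsetSum _ fun a _ => (hα a a).integrable le_top
  rw [h]
  simp [Matrix.trace, blockToeplitz, fourierCoeff, Fintype.sum_prod_type]

/-- The first Szegő limit theorem for powers of an essentially bounded, not necessarily Hermitian
matrix symbol. -/
theorem tendsto_trace_blockToeplitz_pow {α : AddCircle T → Matrix m m ℂ}
    (hα : IsBddSymbol α) (s : ℕ) :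
    Tendsto (fun n : ℕ => (blockToeplitz α n ^ s).trace / (n : ℂ)) atTop
      (𝓝 (∫ t, (α t ^ s).trace ∂haarAddCircle)) := by
  have h0 : Tendsto (fun n : ℕ =>
      (blockToeplitz α n ^ s - blockToeplitz (fun t => α t ^ s) n).trace / (n : ℂ)) atTop
      (𝓝 0) := by
    rw [tendsto_zero_iff_norm_tendsto_zero]
    have hlim := ((tendsto_frobSq_blockToeplitz_pow_sub hα s).const_mul
      (Fintype.card m : ℝ)).sqrt
    rw [mul_zero, Real.sqrt_zero] at hlim
    refine squeeze_zero (fun _ => norm_nonneg _) (fun n => Real.le_sqrt_of_sq_le ?_) hlim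
    rcases Nat.eq_zero_or_pos n with rfl | hn
    · simp
    have hn' : (0 : ℝ) < n := by exact_mod_cast hn
    have := norm_trace_sq_le (blockToeplitz α n ^ s - blockToeplitz (fun t => α t ^ s) n)
    rw [Fintype.card_prod, Fintype.card_fin] at this
    rw [norm_div, div_pow, Complex.norm_natCast, div_le_iff₀ (by positivity)]
    refine this.trans (le_of_eq ?_)
    push_cast
    field_simp
  have h1 := h0.add_const (∫ t, (α t ^ s).trace ∂haarAddCircle)
  rw [zero_add] at h1
  refine h1.congr' ?_
  filter_upwards [eventually_gt_atTop 0] with n hn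
  have hn' : (n : ℂ) ≠ 0 := by exact_mod_cast hn.ne'
  rw [Matrix.trace_sub, trace_blockToeplitz (hα.pow s)]
  field_simp
  ring

end

end

/-! ### Positivity of the symbol -/

section

variable {T : ℝ} [hT : Fact (0 < T)] {m : Type*}

/-- The operator of multiplication by an essentially bounded function on `L²` of the circle. -/
def multOp {f : AddCircle T → ℂ} (hf : MemLp f ⊤ (haarAddCircle (T := T))) :
    Lp ℂ 2 (haarAddCircle (T := T)) →L[ℂ] Lp ℂ 2 (haarAddCircle (T := T)) :=
  (ContinuousLinearMap.mul ℂ ℂ).holderL haarAddCircle ⊤ 2 2 hf.toLp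

theorem coeFn_multOp {f : AddCircle T → ℂ} (hf : MemLp f ⊤ (haarAddCircle (T := T)))
    (u : Lp ℂ 2 (haarAddCircle (T := T))) :
    multOp hf u =ᵐ[haarAddCircle] fun t => f t * u t := by
  have h := (ContinuousLinearMap.mul ℂ ℂ).coeFn_holder (r := 2) hf.toLp u
  filter_upwards [h, hf.coeFn_toLp] with t h1 h2
  rw [multOp, ContinuousLinearMap.holderL_apply_apply, h1, h2]
  rfl

theorem inner_multOp {f : AddCircle T → ℂ} (hf : MemLp f ⊤ (haarAddCircle (T := T)))
    (u v : Lp ℂ 2 (haarAddCircle (T := T))) :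
    inner ℂ u (multOp hf v) = ∫ t, star (u t) * (f t * v t) ∂haarAddCircle := by
  rw [L2.inner_def]
  refine integral_congr_ae ?_
  filter_upwards [coeFn_multOp hf v] with t ht
  rw [ht, RCLike.inner_apply']
  rfl

theorem inner_multOp_fourierLp {f : AddCircle T → ℂ} (hf : MemLp f ⊤ (haarAddCircle (T := T)))
    (i j : ℤ) : inner ℂ (fourierLp 2 i) (multOp hf (fourierLp 2 j)) = fourierCoeff f (i - j) := by
  rw [inner_multOp, ← fourierCoeff_mul_fourier, fourierCoeff]
  refine integral_congr_ae ?_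
  filter_upwards [coeFn_fourierLp (T := T) 2 i, coeFn_fourierLp (T := T) 2 j] with t h1 h2
  rw [h1, h2, fourier_neg]
  rfl

/-- Positivity of all the quadratic forms `∑ x̄_i f̂(i - j) x_j` passes from trigonometric
polynomials to all of `L²`. -/
theorem inner_multOp_nonneg {f : AddCircle T → ℂ} (hf : MemLp f ⊤ (haarAddCircle (T := T)))
    (hpos : ∀ (n : ℕ) (x : Fin n → ℂ),
      0 ≤ ∑ i : Fin n, ∑ j : Fin n, star (x i) * (fourierCoeff f ((i : ℤ) - (j : ℤ)) * x j))
    (u : Lp ℂ 2 (haarAddCircle (T := T))) : 0 ≤ inner ℂ u (multOp hf u) := by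
  have hcont : Continuous fun u : Lp ℂ 2 (haarAddCircle (T := T)) => inner ℂ u (multOp hf u) :=
    continuous_id.inner (multOp hf).continuous
  have hIcc : Tendsto (fun N : ℕ => (Finset.univ : Finset (Fin (2 * N + 1))).map
      ((finToInt _).trans (Equiv.subRight (N : ℤ)).toEmbedding)) atTop atTop := by
    refine tendsto_atTop_finset_of_monotone ?_ ?_
    · intro a b hab i hi
      obtain ⟨l, -, rfl⟩ := Finset.mem_map.1 hi
      have := l.2
      refine Finset.mem_map.2 ⟨⟨l + (b - a), by omega⟩, Finset.mem_univ _, ?_⟩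
      simp
      omega
    · intro i
      refine ⟨i.natAbs, Finset.mem_map.2 ⟨⟨(i + i.natAbs).toNat, by omega⟩, Finset.mem_univ _, ?_⟩⟩
      simp only [Function.Embedding.trans_apply, finToInt_apply, Equiv.coe_toEmbedding,
        Equiv.subRight_apply]
      omega
  have hlim := (hcont.tendsto u).comp ((hasSum_fourier_series_L2 u).comp hIcc)
  refine ge_of_tendsto' hlim fun N => ?_
  have h := hpos (2 * N + 1) fun l => fourierCoeff u ((l : ℤ) - N)
  refine h.trans_eq ?_
  simp only [Function.comp_apply, map_sum, sum_inner, inner_sum, Finset.sum_map, map_smul,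
    inner_smul_left, inner_smul_right, inner_multOp_fourierLp, Finset.mul_sum]
  rw [Finset.sum_comm]
  refine Finset.sum_congr rfl fun i _ => Finset.sum_congr rfl fun j _ => ?_
  simp
  ring

theorem ae_nonneg_of_toeplitz_nonneg {f : AddCircle T → ℂ}
    (hf : MemLp f ⊤ (haarAddCircle (T := T)))
    (hpos : ∀ (n : ℕ) (x : Fin n → ℂ),
      0 ≤ ∑ i : Fin n, ∑ j : Fin n, star (x i) * (fourierCoeff f ((i : ℤ) - (j : ℤ)) * x j)) :
    ∀ᵐ t ∂(haarAddCircle (T := T)), 0 ≤ f t := by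
  have hint : Integrable f (haarAddCircle (T := T)) := hf.integrable le_top
  have hset : ∀ s, MeasurableSet s → 0 ≤ ∫ t in s, f t ∂(haarAddCircle (T := T)) := by
    intro s hs
    have h := inner_multOp_nonneg hf hpos
      (indicatorConstLp 2 hs (measure_ne_top haarAddCircle s) (1 : ℂ))
    refine h.trans_eq ?_
    rw [inner_multOp, ← integral_indicator hs]
    refine integral_congr_ae ?_
    filter_upwards [indicatorConstLp_coeFn (p := 2) (hs := hs)
      (hμs := measure_ne_top haarAddCircle s) (c := (1 : ℂ))] with t ht
    rw [ht]
    by_cases hts : t ∈ s <;> simp [hts]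
  have hre : 0 ≤ᵐ[haarAddCircle (T := T)] fun t => (f t).re :=
    ae_nonneg_of_forall_setIntegral_nonneg hint.re fun s hs _ => by
      have := (Complex.le_def.1 (hset s hs)).1
      rw [← RCLike.re_eq_complex_re, ← integral_re hint.integrableOn] at this
      simpa using this
  have him : (fun t => (f t).im) =ᵐ[haarAddCircle (T := T)] 0 :=
    hint.im.ae_eq_zero_of_forall_setIntegral_eq_zero fun s hs _ => by
      have := (Complex.le_def.1 (hset s hs)).2
      rw [← RCLike.im_eq_complex_im, ← integral_im hint.integrableOn] at this
      simpa using this.symm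
  filter_upwards [hre, him] with t h1 h2
  exact Complex.le_def.2 ⟨h1, h2.symm⟩

theorem ae_eq_of_fourierCoeff_eq {f g : AddCircle T → ℂ}
    (hf : MemLp f 2 (haarAddCircle (T := T))) (hg : MemLp g 2 (haarAddCircle (T := T)))
    (h : ∀ n, fourierCoeff f n = fourierCoeff g n) : f =ᵐ[haarAddCircle] g := by
  have : hf.toLp = hg.toLp := by
    apply fourierBasis.repr.injective
    ext n
    rw [fourierBasis_repr, fourierBasis_repr, fourierCoeff_congr_ae hf.coeFn_toLp,
      fourierCoeff_congr_ae hg.coeFn_toLp, h]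
  exact (MemLp.toLp_eq_toLp_iff hf hg).1 this

theorem posSemidef_of_forall_nonneg [Fintype m] {M : Matrix m m ℂ}
    (h : ∀ x : m → ℂ, 0 ≤ star x ⬝ᵥ M.mulVec x) : M.PosSemidef := by
  classical
  rw [← Matrix.isPositive_toEuclideanLin_iff, LinearMap.isPositive_iff_complex]
  intro x
  have h1 := h x.ofLp
  have h2 : inner ℂ (M.toEuclideanLin x) x = star (star x.ofLp ⬝ᵥ M.mulVec x.ofLp) := by
    rw [EuclideanSpace.inner_eq_star_dotProduct, ← Matrix.star_dotProduct_star]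
    simp [dotProduct_comm]
  have h3 := Complex.le_def.1 h1
  rw [h2]
  refine ⟨Complex.ext ?_ ?_, ?_⟩
  · simp
  · simpa using h3.2.symm
  · simpa using h3.1

/-- A symbol all of whose block Toeplitz matrices are positive semidefinite is positive
semidefinite almost everywhere. -/
theorem ae_posSemidef_of_blockToeplitz [Fintype m] {α : AddCircle T → Matrix m m ℂ}
    (hα : IsBddSymbol α) (hpos : ∀ n, (blockToeplitz α n).PosSemidef) :
    ∀ᵐ t ∂(haarAddCircle (T := T)), (α t).PosSemidef := by
  have hc : ∀ c : m → ℂ, ∀ᵐ t ∂(haarAddCircle (T := T)), 0 ≤ star c ⬝ᵥ (α t).mulVec c := by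
    intro c
    have e : (fun t => star c ⬝ᵥ (α t).mulVec c) =
        fun t => ∑ a, ∑ b, (star (c a) * c b) * α t a b := by
      ext t
      simp only [dotProduct, Matrix.mulVec, Finset.mul_sum, Pi.star_apply]
      exact Finset.sum_congr rfl fun a _ => Finset.sum_congr rfl fun b _ => by ring
    have hmem : ∀ a b, MemLp (fun t => (star (c a) * c b) * α t a b) ⊤ (haarAddCircle (T := T)) :=
      fun a b => (hα a b).const_mul _
    have hmem' : ∀ a, MemLp (fun t => ∑ b, (star (c a) * c b) * α t a b) ⊤
        (haarAddCircle (T := T)) := fun a => memLp_finsetSum _ fun b _ => hmem a b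
    have hcoeff : ∀ l, fourierCoeff (fun t => star c ⬝ᵥ (α t).mulVec c) l =
        ∑ a, ∑ b, (star (c a) * c b) * fourierCoeff (fun t => α t a b) l := by
      intro l
      rw [e, fourierCoeff_finsetSum _ _ fun a _ => hmem' a]
      refine Finset.sum_congr rfl fun a _ => ?_
      rw [fourierCoeff_finsetSum _ _ fun b _ => hmem a b]
      exact Finset.sum_congr rfl fun b _ => fourierCoeff.const_mul _ _ _
    refine ae_nonneg_of_toeplitz_nonneg (f := fun t => star c ⬝ᵥ (α t).mulVec c) ?_ ?_
    · rw [e]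
      exact memLp_finsetSum _ fun a _ => hmem' a
    · intro n x
      have h := (hpos n).dotProduct_mulVec_nonneg fun p => x p.1 * c p.2
      refine h.trans_eq ?_
      simp only [hcoeff]
      simp only [dotProduct, Matrix.mulVec, Fintype.sum_prod_type, blockToeplitz, Matrix.of_apply,
        Pi.star_apply, Finset.mul_sum, Finset.sum_mul]
      refine Finset.sum_congr rfl fun i _ => ?_
      rw [Finset.sum_comm]
      refine Finset.sum_congr rfl fun j _ => Finset.sum_congr rfl fun a _ =>
        Finset.sum_congr rfl fun b _ => ?_
      rw [star_mul]
      ring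
  have hall := ae_all_iff.2 fun k => hc (TopologicalSpace.denseSeq (m → ℂ) k)
  filter_upwards [hall] with t ht
  refine posSemidef_of_forall_nonneg fun c => ?_
  refine (TopologicalSpace.denseRange_denseSeq (m → ℂ)).induction_on
    (p := fun c => 0 ≤ star c ⬝ᵥ (α t).mulVec c) c ?_ ht
  refine isClosed_le continuous_const ?_
  exact continuous_star.dotProduct ((continuous_const (y := α t)).matrix_mulVec continuous_id)

end

/-! ### Williamson normal form and symplectic spectra -/

/-- An injective skew-symmetric operator on a real Euclidean space of dimension `2N` is, in a
suitable orthonormal basis, a direct sum of `N` blocks `d i • J₂`. -/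
theorem exists_orthonormal_skew_normal_form (N : ℕ) :
    ∀ {E : Type*} [NormedAddCommGroup E] [InnerProductSpace ℝ E] [FiniteDimensional ℝ E]
      (_ : Module.finrank ℝ E = 2 * N) (K : E →ₗ[ℝ] E)
      (_ : ∀ x y, inner ℝ (K x) y = -inner ℝ x (K y)) (_ : Function.Injective K),
      ∃ (e : Fin N × Fin 2 → E) (d : Fin N → ℝ), Orthonormal ℝ e ∧ (∀ i, 0 < d i) ∧
        ∀ i, K (e (i, 0)) = -d i • e (i, 1) ∧ K (e (i, 1)) = d i • e (i, 0) := by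
  induction N with
  | zero =>
    intro E _ _ _ _ K _ _
    exact ⟨fun p => p.1.elim0, fun i => i.elim0, ⟨fun p => p.1.elim0, fun p => p.1.elim0⟩,
      fun i => i.elim0, fun i => i.elim0⟩
  | succ N ih =>
    intro E _ _ _ hE K hskew hinj
    have hT : (K ∘ₗ K).IsSymmetric := fun x y => by
      simp [hskew]
    -- a unit eigenvector of the symmetric operator `K²` spans the first block together with `K x`
    obtain ⟨x, μ, hx1, hx⟩ : ∃ (x : E) (μ : ℝ), ‖x‖ = 1 ∧ K (K x) = μ • x :=
      ⟨hT.eigenvectorBasis hE ⟨0, by omega⟩, _,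
        (hT.eigenvectorBasis hE).orthonormal.1 _, hT.apply_eigenvectorBasis hE ⟨0, by omega⟩⟩
    have hx0 : K x ≠ 0 := fun h => by
      have : x = 0 := hinj (by simpa using h)
      simp [this] at hx1
    set d : ℝ := ‖K x‖ with hd
    have hdpos : 0 < d := norm_pos_iff.2 hx0
    have hμ : μ = -d ^ 2 := by
      have h1 := hskew x (K x)
      rw [hx, inner_smul_right, real_inner_self_eq_norm_sq, real_inner_self_eq_norm_sq, hx1] at h1
      linarith
    set y : E := -d⁻¹ • K x with hy
    have hKx : K x = -d • y := by
      rw [hy, smul_smul]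
      field_simp
      simp
    have hKy : K y = d • x := by
      rw [hy, map_smul, hx, smul_smul, hμ]
      congr 1
      field_simp
    have hy1 : ‖y‖ = 1 := by
      rw [hy, norm_smul, norm_neg, norm_inv, Real.norm_of_nonneg hdpos.le, hd.symm]
      exact inv_mul_cancel₀ hdpos.ne'
    have hxy : inner ℝ x y = 0 := by
      have h1 := hskew x x
      rw [real_inner_comm] at h1
      have h2 : inner ℝ x (K x) = 0 := by linarith
      rw [hy, inner_smul_right, h2, mul_zero]
    have hon : Orthonormal ℝ ![x, y] := by
      refine ⟨?_, ?_⟩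
      · intro i
        fin_cases i <;> simp [hx1, hy1]
      · intro i j hij
        fin_cases i <;> fin_cases j
        exacts [absurd rfl hij, hxy, (real_inner_comm x y).trans hxy, absurd rfl hij]
    set W : Submodule ℝ E := Submodule.span ℝ (Set.range ![x, y]) with hW
    have hWrank : Module.finrank ℝ W = 2 := by
      rw [hW, finrank_span_eq_card hon.linearIndependent, Fintype.card_fin]
    have hWo : Module.finrank ℝ Wᗮ = 2 * N := by
      have := W.finrank_add_finrank_orthogonal
      omega
    have hmem : ∀ z : E, z ∈ Wᗮ ↔ inner ℝ x z = 0 ∧ inner ℝ y z = 0 := by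
      intro z
      rw [hW, Submodule.mem_orthogonal]
      constructor
      · intro h
        exact ⟨h x (Submodule.subset_span ⟨0, rfl⟩), h y (Submodule.subset_span ⟨1, rfl⟩)⟩
      · rintro ⟨h0, h1⟩ u hu
        induction hu using Submodule.span_induction with
        | mem u hu =>
          obtain ⟨i, rfl⟩ := hu
          fin_cases i
          exacts [h0, h1]
        | zero => simp
        | add u v _ _ hu hv => rw [inner_add_left, hu, hv, add_zero]
        | smul a u _ hu => rw [inner_smul_left, hu, mul_zero]
    have hinv : ∀ z ∈ Wᗮ, K z ∈ Wᗮ := by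
      intro z hz
      rw [hmem] at hz ⊢
      have h1 := hskew x z
      have h2 := hskew y z
      rw [hKx, inner_smul_left, hz.2, mul_zero] at h1
      rw [hKy, inner_smul_left, hz.1, mul_zero] at h2
      exact ⟨by linarith, by linarith⟩
    obtain ⟨e', d', he', hd', hK'⟩ := ih hWo (K.restrict hinv)
      (fun u v => hskew u v) (fun u v huv => by
        have := congrArg Subtype.val huv
        exact Subtype.ext (hinj this))
    refine ⟨fun p => Fin.cases (![x, y] p.2) (fun i => (e' (i, p.2) : E)) p.1,
      Fin.cons d d', ?_, ?_, ?_⟩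
    · rw [orthonormal_iff_ite] at he' hon ⊢
      rintro ⟨i, s⟩ ⟨j, t⟩
      have hort : ∀ (u : Fin 2) (z : Wᗮ), inner ℝ (![x, y] u) (z : E) = 0 := by
        intro u z
        have := (hmem z).1 z.2
        fin_cases u
        exacts [this.1, this.2]
      induction i using Fin.cases with
      | zero =>
        induction j using Fin.cases with
        | zero => simpa using hon s t
        | succ j => simpa [Prod.ext_iff, (Fin.succ_ne_zero j).symm] using hort s (e' (j, t))
      | succ i =>
        induction j using Fin.cases with
        | zero =>
          simpa [Prod.ext_iff, Fin.succ_ne_zero i, real_inner_comm] using hort t (e' (i, s))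
        | succ j => simpa [Prod.ext_iff] using he' (i, s) (j, t)
    · intro i
      induction i using Fin.cases with
      | zero => exact hdpos
      | succ i => exact hd' i
    · intro i
      induction i using Fin.cases with
      | zero => exact ⟨hKx, hKy⟩
      | succ i =>
        exact ⟨congrArg Subtype.val (hK' i).1, congrArg Subtype.val (hK' i).2⟩

section J

variable {ι R : Type*} [DecidableEq ι] [CommRing R]

theorem J_apply (p q : ι × Fin 2) :
    J ι R p q = if p.1 = q.1 then (!![0, 1; -1, 0] : Matrix (Fin 2) (Fin 2) R) p.2 q.2 else 0 := by
  rw [J, Matrix.kroneckerMap_apply, Matrix.one_apply]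
  split_ifs <;> simp

theorem J_transpose : (J ι R).transpose = -J ι R := by
  ext ⟨i, s⟩ ⟨j, t⟩
  by_cases h : i = j
  · subst h
    fin_cases s <;> fin_cases t <;> simp [J_apply]
  · simp [J_apply, h, Ne.symm h]

variable [Fintype ι]

theorem J_mul_J : J ι R * J ι R = -1 := by
  have h : (!![0, 1; -1, 0] : Matrix (Fin 2) (Fin 2) R) * !![0, 1; -1, 0] = -1 := by
    ext s t
    fin_cases s <;> fin_cases t <;> simp
  rw [J, ← Matrix.mul_kronecker_mul, h, one_mul]
  ext ⟨i, s⟩ ⟨j, t⟩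
  by_cases h1 : i = j <;> by_cases h2 : s = t <;>
    simp [Matrix.kroneckerMap_apply, h1, h2]

theorem J_mul_diagonal (d : ι → R) :
    J ι R * Matrix.diagonal (fun p : ι × Fin 2 => d p.1) =
      Matrix.diagonal (fun p : ι × Fin 2 => d p.1) * J ι R := by
  ext p q
  rw [Matrix.mul_diagonal, Matrix.diagonal_mul, J_apply]
  split_ifs with h
  · rw [h, mul_comm]
  · simp

end J

section Williamson

variable {ι : Type*} [Fintype ι] [DecidableEq ι]

/-- **Williamson's theorem**, existence part. -/
theorem exists_isWilliamsonSpectrum {A : Matrix (ι × Fin 2) (ι × Fin 2) ℝ} (hA : A.PosDef) :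
    ∃ d, IsWilliamsonSpectrum A d := by
  obtain ⟨B, hB⟩ : ∃ B : Matrix (ι × Fin 2) (ι × Fin 2) ℝ, A = B.transpose * B := by
    open scoped MatrixOrder in
    obtain ⟨B, hB⟩ := CStarAlgebra.nonneg_iff_eq_star_mul_self.mp hA.posSemidef.nonneg
    exact ⟨B, by rw [hB, Matrix.star_eq_conjTranspose, Matrix.conjTranspose_eq_transpose_of_trivial]⟩
  have hBdet : IsUnit B.det := by
    have := hA.det_pos
    rw [hB, Matrix.det_mul, Matrix.det_transpose] at this
    exact (mul_self_pos.1 this).isUnit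
  have hBtdet : IsUnit B.transpose.det := by rwa [Matrix.det_transpose]
  -- an orthogonal `O` with `O K Oᵀ = ⨁ δ i • J₂` gives `M = (⨁ δ i ^ (-1/2) • 1) O (Bᵀ)⁻¹`
  set K : Matrix (ι × Fin 2) (ι × Fin 2) ℝ := B.transpose⁻¹ * J ι ℝ * B⁻¹ with hK
  have hKt : K.transpose = -K := by
    rw [hK, Matrix.transpose_mul, Matrix.transpose_mul, J_transpose, Matrix.transpose_nonsing_inv,
      Matrix.transpose_nonsing_inv, Matrix.transpose_transpose]
    simp [mul_assoc]
  have hKunit : (B * J ι ℝ * B.transpose) * K = -1 := by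
    calc (B * J ι ℝ * B.transpose) * K
        = B * J ι ℝ * (B.transpose * B.transpose⁻¹) * J ι ℝ * B⁻¹ := by
          simp only [hK, mul_assoc]
      _ = B * (J ι ℝ * J ι ℝ) * B⁻¹ := by
          rw [Matrix.mul_nonsing_inv _ hBtdet]; simp only [mul_assoc, one_mul]
      _ = -1 := by
          rw [J_mul_J, mul_neg, mul_one, neg_mul, Matrix.mul_nonsing_inv _ hBdet]
  have hdot : ∀ x y : ι × Fin 2 → ℝ, K.mulVec x ⬝ᵥ y = -(x ⬝ᵥ K.mulVec y) := by
    intro x y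
    rw [Matrix.dotProduct_mulVec, ← Matrix.mulVec_transpose, hKt, Matrix.neg_mulVec,
      neg_dotProduct, neg_neg]
  have hKlin : ∀ x, (K.toEuclideanLin x).ofLp = K.mulVec x.ofLp := fun _ => rfl
  obtain ⟨e, δ, he, hδ, hKe⟩ := exists_orthonormal_skew_normal_form (Fintype.card ι)
    (E := EuclideanSpace ℝ (ι × Fin 2)) (by simp [mul_comm]) K.toEuclideanLin
    (fun x y => by
      simp only [EuclideanSpace.inner_eq_star_dotProduct, star_trivial, hKlin]
      rw [dotProduct_comm, hdot, dotProduct_comm])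
    (fun x y hxy => by
      have h := congrArg (fun z => (B * J ι ℝ * B.transpose).mulVec (WithLp.ofLp z)) hxy
      simp only [hKlin, Matrix.mulVec_mulVec, hKunit] at h
      exact WithLp.ofLp_injective 2 (by simpa [Matrix.neg_mulVec] using h))
  let f := Fintype.equivFin ι
  set O : Matrix (ι × Fin 2) (ι × Fin 2) ℝ := Matrix.of fun p q => e (f p.1, p.2) q with hO
  have hOO : O * O.transpose = 1 := by
    ext p q
    have h := orthonormal_iff_ite.1 he (f p.1, p.2) (f q.1, q.2)
    rw [EuclideanSpace.inner_eq_star_dotProduct, star_trivial, dotProduct_comm] at h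
    have h' : (O * O.transpose) p q = (e (f p.1, p.2)).ofLp ⬝ᵥ (e (f q.1, q.2)).ofLp := rfl
    rw [h', h, Matrix.one_apply]
    simp [Prod.ext_iff]
  have hOK : O * K * O.transpose =
      Matrix.diagonal (fun p : ι × Fin 2 => δ (f p.1)) * J ι ℝ := by
    have hmv : ∀ q, K.mulVec (O q) = ∑ r, (δ (f q.1) * J ι ℝ r q) • O r := by
      rintro ⟨i, s⟩
      have h0 := congrArg WithLp.ofLp (hKe (f i)).1
      have h1 := congrArg WithLp.ofLp (hKe (f i)).2
      rw [hKlin] at h0 h1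
      have hrow : ∀ p, O p = (e (f p.1, p.2)).ofLp := fun _ => rfl
      have hsum : ∑ r, (δ (f i) * J ι ℝ r (i, s)) • O r =
          ∑ t : Fin 2, (δ (f i) * J ι ℝ (i, t) (i, s)) • O (i, t) := by
        rw [Fintype.sum_prod_type, Finset.sum_eq_single i]
        · intro j _ hj
          simp [J_apply, hj]
        · simp
      rw [hsum]
      fin_cases s
      · simpa [J_apply, Fin.sum_univ_two, hrow] using h0
      · simpa [J_apply, Fin.sum_univ_two, hrow] using h1
    have hent : ∀ p q, (O * K * O.transpose) p q = O p ⬝ᵥ K.mulVec (O q) := by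
      intro p q
      rw [mul_assoc]
      rfl
    have hdo : ∀ p r, O p ⬝ᵥ O r = if p = r then 1 else 0 := fun p r => by
      rw [← Matrix.one_apply, ← hOO]; rfl
    ext p q
    rw [hent, hmv, dotProduct_sum, Matrix.diagonal_mul]
    simp only [dotProduct_smul, hdo, smul_eq_mul, mul_ite, mul_one, mul_zero, Finset.sum_ite_eq,
      Finset.mem_univ, if_true, J_apply]
    split_ifs with h
    · rw [h]
    · simp
  set D : Matrix (ι × Fin 2) (ι × Fin 2) ℝ :=
    Matrix.diagonal (fun p : ι × Fin 2 => √(δ (f p.1))⁻¹) with hD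
  have hDt : D.transpose = D := Matrix.diagonal_transpose _
  have hOJ : O * B.transpose⁻¹ * J ι ℝ * (B⁻¹ * O.transpose) = O * K * O.transpose := by
    simp only [hK, mul_assoc]
  have hOA : O * B.transpose⁻¹ * A * (B⁻¹ * O.transpose) = 1 := by
    rw [hB, ← hOO]
    calc _ = O * (B.transpose⁻¹ * B.transpose) * (B * B⁻¹) * O.transpose := by
          simp only [mul_assoc]
      _ = _ := by
          rw [Matrix.nonsing_inv_mul _ hBtdet, Matrix.mul_nonsing_inv _ hBdet, mul_one, mul_one]
  have hMt : (D * (O * B.transpose⁻¹)).transpose = B⁻¹ * O.transpose * D := by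
    rw [Matrix.transpose_mul, Matrix.transpose_mul, Matrix.transpose_nonsing_inv,
      Matrix.transpose_transpose, hDt]
  refine ⟨fun i => (δ (f i))⁻¹, fun i => inv_pos.2 (hδ _), D * (O * B.transpose⁻¹), ?_, ?_⟩
  · rw [IsSymplectic, hMt]
    calc _ = D * (O * B.transpose⁻¹ * J ι ℝ * (B⁻¹ * O.transpose)) * D := by
          simp only [mul_assoc]
      _ = J ι ℝ := by
          rw [hOJ, hOK, mul_assoc, mul_assoc, J_mul_diagonal (fun i => √(δ (f i))⁻¹), ← mul_assoc,
            ← mul_assoc, hD, Matrix.diagonal_mul_diagonal, Matrix.diagonal_mul_diagonal]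
          convert one_mul (J ι ℝ)
          rw [← Matrix.diagonal_one]
          congr 1
          ext p
          have h1 := hδ (f p.1)
          have h2 : √(δ (f p.1))⁻¹ * √(δ (f p.1))⁻¹ = (δ (f p.1))⁻¹ :=
            Real.mul_self_sqrt (inv_nonneg.2 h1.le)
          rw [mul_right_comm, h2, inv_mul_cancel₀ h1.ne']
  · rw [hMt]
    calc _ = D * (O * B.transpose⁻¹ * A * (B⁻¹ * O.transpose)) * D := by
          simp only [mul_assoc]
      _ = _ := by
          rw [hOA, mul_one, hD, Matrix.diagonal_mul_diagonal]
          congr 1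
          ext p
          exact Real.mul_self_sqrt (inv_nonneg.2 (hδ _).le)

theorem isWilliamsonSpectrum_symplecticEigenvalues {A : Matrix (ι × Fin 2) (ι × Fin 2) ℝ}
    (hA : A.PosDef) : IsWilliamsonSpectrum A (symplecticEigenvalues A) := by
  have h := exists_isWilliamsonSpectrum hA
  rw [symplecticEigenvalues, dif_pos h]
  exact h.choose_spec

theorem IsSymplectic.transpose_mul_J_mul {M : Matrix (ι × Fin 2) (ι × Fin 2) ℝ}
    (hM : IsSymplectic M) : M.transpose * J ι ℝ * M = J ι ℝ := by
  have h1 : M * (-(J ι ℝ * M.transpose * J ι ℝ)) = 1 := by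
    rw [mul_neg, ← mul_assoc, ← mul_assoc, hM, J_mul_J, neg_neg]
  have h2 := congrArg (J ι ℝ * ·) (mul_eq_one_comm.1 h1)
  simp only [mul_one] at h2
  conv_rhs => rw [← h2]
  simp only [neg_mul, mul_neg, ← mul_assoc, J_mul_J, one_mul, neg_neg]

theorem IsSymplectic.isUnit_det {M : Matrix (ι × Fin 2) (ι × Fin 2) ℝ}
    (hM : IsSymplectic M) : IsUnit M.det := by
  have h1 : M * (-(J ι ℝ * M.transpose * J ι ℝ)) = 1 := by
    rw [mul_neg, ← mul_assoc, ← mul_assoc, hM, J_mul_J, neg_neg]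
  exact Matrix.isUnit_det_of_right_inverse h1

/-- Traces of even powers of `J A` are, up to a factor `±2`, the power sums of the `d i ^ 2`: `J A`
is similar to `⨁ d i • J₂`, whose square is `-⨁ d i ^ 2 • 1`. -/
theorem trace_J_mul_pow {A : Matrix (ι × Fin 2) (ι × Fin 2) ℝ} {d : ι → ℝ}
    (hd : IsWilliamsonSpectrum A d) (r : ℕ) :
    ((J ι ℝ * A) ^ (2 * r)).trace = (-1) ^ r * (2 * ∑ i, (d i ^ 2) ^ r) := by
  obtain ⟨-, M, hM, hMA⟩ := hd
  set D : Matrix (ι × Fin 2) (ι × Fin 2) ℝ := Matrix.diagonal fun p => d p.1 with hD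
  have hsemi : SemiconjBy M.transpose (J ι ℝ * D) (J ι ℝ * A) := by
    rw [SemiconjBy, ← hMA]
    calc _ = M.transpose * J ι ℝ * M * (A * M.transpose) := by simp only [mul_assoc]
      _ = _ := by rw [hM.transpose_mul_J_mul, mul_assoc]
  have hdet : IsUnit M.transpose.det := by rw [Matrix.det_transpose]; exact hM.isUnit_det
  have hpow := (hsemi.pow_right (2 * r)).eq
  have h1 : (J ι ℝ * A) ^ (2 * r) = M.transpose * (J ι ℝ * D) ^ (2 * r) * M.transpose⁻¹ := by
    rw [hpow, mul_assoc, Matrix.mul_nonsing_inv _ hdet, mul_one]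
  have h2 : (J ι ℝ * D) ^ 2 = -(D * D) := by
    calc (J ι ℝ * D) ^ 2 = J ι ℝ * (D * J ι ℝ) * D := by rw [sq]; simp only [mul_assoc]
      _ = -(D * D) := by
        rw [hD, ← J_mul_diagonal d, ← mul_assoc, J_mul_J]
        simp
  rw [h1, Matrix.trace_mul_cycle, Matrix.nonsing_inv_mul _ hdet, one_mul, pow_mul, h2,
    neg_pow, hD, Matrix.diagonal_mul_diagonal, Matrix.diagonal_pow]
  have h3 : ((-1 : Matrix (ι × Fin 2) (ι × Fin 2) ℝ)) ^ r = (-1 : ℝ) ^ r • 1 := by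
    rcases Nat.even_or_odd r with h | h <;> simp [h.neg_one_pow]
  rw [h3, smul_mul_assoc, one_mul, Matrix.trace_smul, Matrix.trace_diagonal, smul_eq_mul,
    Fintype.sum_prod_type]
  congr 1
  rw [Finset.mul_sum]
  refine Finset.sum_congr rfl fun i _ => ?_
  rw [Fin.sum_univ_two]
  simp only [Pi.pow_apply]
  ring

/-- The uncertainty relation for a pair of real vectors. -/
theorem dotProduct_J_mulVec_le {A : Matrix (ι × Fin 2) (ι × Fin 2) ℝ}
    (hA : (A.map (fun x : ℝ => (x : ℂ)) + (Complex.I / 2) • J ι ℂ).PosSemidef)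
    (u v : ι × Fin 2 → ℝ) :
    u ⬝ᵥ (J ι ℝ).mulVec v ≤ u ⬝ᵥ A.mulVec u + v ⬝ᵥ A.mulVec v := by
  have h := (Complex.le_def.1 (hA.dotProduct_mulVec_nonneg
    fun p => (u p : ℂ) + Complex.I * (v p : ℂ))).1
  have hJ : v ⬝ᵥ (J ι ℝ).mulVec u = -(u ⬝ᵥ (J ι ℝ).mulVec v) := by
    rw [Matrix.dotProduct_mulVec, ← Matrix.mulVec_transpose, J_transpose, Matrix.neg_mulVec,
      neg_dotProduct, dotProduct_comm]
  have hJc : ∀ p q, J ι ℂ p q = ((J ι ℝ p q : ℝ) : ℂ) := by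
    rintro ⟨i, s⟩ ⟨j, t⟩
    by_cases hij : i = j
    · fin_cases s <;> fin_cases t <;> simp [J_apply, hij]
    · simp [J_apply, hij]
  have key : (star (fun p => (u p : ℂ) + Complex.I * (v p : ℂ)) ⬝ᵥ
      (A.map (fun x : ℝ => (x : ℂ)) + (Complex.I / 2) • J ι ℂ).mulVec
        fun p => (u p : ℂ) + Complex.I * (v p : ℂ)).re =
      u ⬝ᵥ A.mulVec u + v ⬝ᵥ A.mulVec v -
        (1 / 2) * (u ⬝ᵥ (J ι ℝ).mulVec v) + (1 / 2) * (v ⬝ᵥ (J ι ℝ).mulVec u) := by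
    simp only [dotProduct, Matrix.mulVec, Complex.re_sum, Finset.mul_sum,
      ← Finset.sum_add_distrib, ← Finset.sum_sub_distrib]
    refine Finset.sum_congr rfl fun p _ => Finset.sum_congr rfl fun q _ => ?_
    simp [hJc]
    ring
  rw [key, hJ] at h
  simp only [Complex.zero_re] at h
  linarith

/-- For real matrices the uncertainty relation alone implies positive definiteness. -/
theorem isGMatrix_of_posSemidef {A : Matrix (ι × Fin 2) (ι × Fin 2) ℝ}
    (hA : (A.map (fun x : ℝ => (x : ℂ)) + (Complex.I / 2) • J ι ℂ).PosSemidef) :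
    IsGMatrix A := by
  refine ⟨Matrix.PosDef.of_dotProduct_mulVec_pos ?_ fun x hx => ?_, hA⟩
  · ext p q
    have h : A q p + (Complex.I / 2 * J ι ℂ q p).re = A p q + (Complex.I / 2 * J ι ℂ p q).re :=
      congrArg Complex.re (congrFun (congrFun hA.1 p) q)
    have hre : ∀ p q, (Complex.I / 2 * J ι ℂ p q).re = 0 := by
      rintro ⟨i, s⟩ ⟨j, t⟩
      by_cases hij : i = j
      · fin_cases s <;> fin_cases t <;> simp [J_apply, hij]
      · simp [J_apply, hij]
    rwa [hre, hre, add_zero, add_zero] at h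
  · rw [star_trivial]
    by_contra hle
    push Not at hle
    have hxx : 0 < x ⬝ᵥ x :=
      lt_of_le_of_ne (Finset.sum_nonneg fun _ _ => mul_self_nonneg _) fun h =>
        hx (dotProduct_self_eq_zero.1 h.symm)
    -- test the relation on the pair `x`, `-s J x` with a small `s > 0`
    set c : ℝ := (J ι ℝ).mulVec x ⬝ᵥ A.mulVec ((J ι ℝ).mulVec x) with hc
    set s : ℝ := (x ⬝ᵥ x) / (2 * (|c| + 1)) with hs
    have hspos : 0 < s := by positivity
    have h := dotProduct_J_mulVec_le hA x (-s • (J ι ℝ).mulVec x)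
    rw [Matrix.mulVec_smul, Matrix.mulVec_smul, Matrix.mulVec_mulVec, J_mul_J, dotProduct_smul,
      dotProduct_smul, smul_dotProduct, ← hc, Matrix.neg_mulVec, Matrix.one_mulVec,
      dotProduct_neg] at h
    simp only [smul_eq_mul] at h
    have h2 : x ⬝ᵥ x ≤ s * c := by
      have : s * (x ⬝ᵥ x) ≤ s * (s * c) := by linarith
      exact le_of_mul_le_mul_left this hspos
    have h3 : s * c ≤ (x ⬝ᵥ x) / 2 := by
      have h4 : s * (|c| + 1) = (x ⬝ᵥ x) / 2 := by
        rw [hs]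
        field_simp
      nlinarith [le_abs_self c]
    linarith

theorem IsSymplectic.dotProduct_J_mulVec {M : Matrix (ι × Fin 2) (ι × Fin 2) ℝ}
    (hM : IsSymplectic M) (p q : ι × Fin 2) : M p ⬝ᵥ (J ι ℝ).mulVec (M q) = J ι ℝ p q := by
  conv_rhs => rw [← hM]
  rw [mul_assoc]
  rfl

/-- The symplectic eigenvalues are bounded by the operator norm: the rows `x`, `y` of `M` that
belong to one mode satisfy `A x = d J y` and `A y = -d J x`. -/
theorem sq_le_of_isWilliamsonSpectrum {A : Matrix (ι × Fin 2) (ι × Fin 2) ℝ} {d : ι → ℝ} {C : ℝ}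
    (hd : IsWilliamsonSpectrum A d)
    (hC : ∀ x : ι × Fin 2 → ℝ, A.mulVec x ⬝ᵥ A.mulVec x ≤ C * (x ⬝ᵥ x)) (i : ι) :
    d i ^ 2 ≤ C := by
  obtain ⟨-, M, hM, hMA⟩ := hd
  have hJJ : ∀ x : ι × Fin 2 → ℝ, (J ι ℝ).mulVec x ⬝ᵥ (J ι ℝ).mulVec x = x ⬝ᵥ x := by
    intro x
    rw [Matrix.dotProduct_mulVec, ← Matrix.mulVec_transpose, J_transpose, Matrix.mulVec_mulVec,
      neg_mul, J_mul_J]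
    simp
  have hAM : A * M.transpose =
      -(J ι ℝ) * M.transpose * (J ι ℝ * Matrix.diagonal fun p => d p.1) := by
    rw [← hMA]
    calc A * M.transpose = -(J ι ℝ * J ι ℝ) * (A * M.transpose) := by rw [J_mul_J]; simp
      _ = -(J ι ℝ) * (M.transpose * J ι ℝ * M) * (A * M.transpose) := by
        rw [hM.transpose_mul_J_mul]; simp
      _ = _ := by simp only [mul_assoc, neg_mul]
  have hAv : ∀ q, A.mulVec (M q) = ∑ r, (-(J ι ℝ r q * d q.1)) • (J ι ℝ).mulVec (M r) := by
    intro q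
    ext p
    have h := congrFun (congrFun hAM p) q
    rw [Matrix.mul_apply, Matrix.mul_apply] at h
    rw [Finset.sum_apply]
    refine h.trans (Finset.sum_congr rfl fun r _ => ?_)
    rw [Matrix.mul_diagonal, neg_mul, Matrix.neg_apply, Pi.smul_apply, smul_eq_mul]
    change -((J ι ℝ).mulVec (M r) p) * _ = _
    ring
  have hsum : ∀ q : ι × Fin 2, ∑ r, (-(J ι ℝ r q * d q.1)) • (J ι ℝ).mulVec (M r) =
      ∑ t : Fin 2, (-(J ι ℝ (q.1, t) q * d q.1)) • (J ι ℝ).mulVec (M (q.1, t)) := by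
    intro q
    rw [Fintype.sum_prod_type, Finset.sum_eq_single q.1]
    · intro j _ hj
      simp [J_apply, hj]
    · simp
  have h0 : A.mulVec (M (i, 0)) = d i • (J ι ℝ).mulVec (M (i, 1)) := by
    rw [hAv, hsum]
    simp [J_apply, Fin.sum_univ_two]
  have h1 : A.mulVec (M (i, 1)) = -d i • (J ι ℝ).mulVec (M (i, 0)) := by
    rw [hAv, hsum]
    simp [J_apply, Fin.sum_univ_two]
  have c0 := hC (M (i, 0))
  have c1 := hC (M (i, 1))
  rw [h0, smul_dotProduct, dotProduct_smul, hJJ] at c0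
  rw [h1, smul_dotProduct, dotProduct_smul, hJJ] at c1
  simp only [smul_eq_mul] at c0 c1
  have n0 : 0 ≤ M (i, 0) ⬝ᵥ M (i, 0) := Finset.sum_nonneg fun _ _ => mul_self_nonneg _
  have n1 : 0 < M (i, 1) ⬝ᵥ M (i, 1) := by
    refine lt_of_le_of_ne (Finset.sum_nonneg fun _ _ => mul_self_nonneg _) fun h => ?_
    have hz := dotProduct_self_eq_zero.1 h.symm
    have := hM.dotProduct_J_mulVec (i, 0) (i, 1)
    rw [hz] at this
    simp [J_apply] at this
  by_contra hlt
  push Not at hlt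
  nlinarith

end Williamson

/-! ### Entropy as a limit of polynomial traces -/

/-- The contribution of a symplectic eigenvalue `d` to the entropy, as a function of `x = d²`. It is
continuous on all of `ℝ`, because `2√x + 1` never vanishes. -/
def entropyProfile (x : ℝ) : ℝ :=
  (2 * √x + 1) / 2 * Real.binEntropy ((2 * √x - 1) / (2 * √x + 1))

theorem continuous_entropyProfile : Continuous entropyProfile := by
  have h : ∀ x : ℝ, 2 * √x + 1 ≠ 0 := fun x => by positivity
  unfold entropyProfile
  refine Continuous.mul (by fun_prop) (Real.binEntropy_continuous.comp ?_)
  exact Continuous.div (by fun_prop) (by fun_prop) h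

section

variable {ι : Type*} [Fintype ι] [DecidableEq ι]

/-- `½ tr p(-(J A)²)`, which equals `∑ p(d_j²)` for the symplectic eigenvalues `d_j` of `A`. -/
def polyTrace (p : Polynomial ℝ) (A : Matrix (ι × Fin 2) (ι × Fin 2) ℝ) : ℝ :=
  ∑ r ∈ Finset.range (p.natDegree + 1),
    p.coeff r * ((-1) ^ r / 2 * ((J ι ℝ * A) ^ (2 * r)).trace)

theorem polyTrace_eq (p : Polynomial ℝ) {A : Matrix (ι × Fin 2) (ι × Fin 2) ℝ} {d : ι → ℝ}
    (hd : IsWilliamsonSpectrum A d) : polyTrace p A = ∑ i, p.eval (d i ^ 2) := by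
  simp only [Polynomial.eval_eq_sum_range]
  rw [Finset.sum_comm, polyTrace]
  refine Finset.sum_congr rfl fun r _ => ?_
  rw [trace_J_mul_pow hd, ← Finset.mul_sum]
  have : ((-1 : ℝ) ^ r) * (-1) ^ r = 1 := by rw [← mul_pow]; simp
  linear_combination (p.coeff r * ∑ i, (d i ^ 2) ^ r) * this

theorem entropy_eq {A : Matrix (ι × Fin 2) (ι × Fin 2) ℝ}
    (hd : IsWilliamsonSpectrum A (symplecticEigenvalues A)) :
    entropy A = ∑ i, entropyProfile (symplecticEigenvalues A i ^ 2) := by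
  refine Finset.sum_congr rfl fun i _ => ?_
  rw [entropyProfile, Real.sqrt_sq (hd.1 i).le]

theorem abs_entropy_sub_polyTrace_le {A : Matrix (ι × Fin 2) (ι × Fin 2) ℝ} (hA : A.PosDef)
    {C ε : ℝ} (hC : ∀ x : ι × Fin 2 → ℝ, A.mulVec x ⬝ᵥ A.mulVec x ≤ C * (x ⬝ᵥ x))
    {p : Polynomial ℝ} (hp : ∀ x ∈ Set.Icc 0 C, |p.eval x - entropyProfile x| < ε) :
    |entropy A - polyTrace p A| ≤ Fintype.card ι * ε := by
  have hd := isWilliamsonSpectrum_symplecticEigenvalues hA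
  rw [entropy_eq hd, polyTrace_eq p hd, ← Finset.sum_sub_distrib]
  refine (Finset.abs_sum_le_sum_abs _ _).trans ?_
  refine (Finset.sum_le_card_nsmul _ _ ε fun i _ => ?_).trans_eq (by simp)
  rw [abs_sub_comm]
  exact (hp _ ⟨sq_nonneg _, sq_le_of_isWilliamsonSpectrum hd hC i⟩).le

end

theorem tendsto_of_forall_approx {x : ℕ → ℝ} {L : ℝ}
    (h : ∀ ε > 0, ∃ (y : ℕ → ℝ) (M : ℝ), Tendsto y atTop (𝓝 M) ∧ (∀ n, |x n - y n| ≤ ε) ∧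
      |L - M| ≤ ε) : Tendsto x atTop (𝓝 L) := by
  rw [Metric.tendsto_atTop]
  intro ε hε
  obtain ⟨y, M, hy, hxy, hLM⟩ := h (ε / 4) (by positivity)
  obtain ⟨N, hN⟩ := Metric.tendsto_atTop.1 hy (ε / 4) (by positivity)
  refine ⟨N, fun n hn => ?_⟩
  have h1 := hN n hn
  have h2 := hxy n
  rw [Real.dist_eq] at h1 ⊢
  rw [abs_le] at h2 hLM
  rw [abs_lt] at h1 ⊢
  constructor <;> linarith

section Circle

variable {T : ℝ} [hT : Fact (0 < T)] {k : ℕ}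
  {A : ℤ → Matrix (Fin k × Fin 2) (Fin k × Fin 2) ℝ}
  {α : AddCircle T → Matrix (Fin k × Fin 2) (Fin k × Fin 2) ℂ}

/-- The real blocks `A n` are the Fourier coefficients of the symbol `α` on the circle. -/
def HasFourierBlocks (α : AddCircle T → Matrix (Fin k × Fin 2) (Fin k × Fin 2) ℂ)
    (A : ℤ → Matrix (Fin k × Fin 2) (Fin k × Fin 2) ℝ) : Prop :=
  ∀ n a b, fourierCoeff (fun t => α t a b) n = (A n a b : ℂ)

theorem blockToeplitz_eq_submatrix (h : HasFourierBlocks α A) (n : ℕ) :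
    blockToeplitz α n = ((truncation A n).map (fun x : ℝ => (x : ℂ))).submatrix
      (Equiv.prodAssoc _ _ _).symm (Equiv.prodAssoc _ _ _).symm := by
  ext p q
  simp [blockToeplitz, h _ _ _, truncation]

theorem J_prod_apply (R : Type*) [CommRing R] (n : ℕ) (i j : Fin n) (a b : Fin k × Fin 2) :
    J (Fin n × Fin k) R ((i, a.1), a.2) ((j, b.1), b.2) = if i = j then J (Fin k) R a b else 0 := by
  by_cases h : i = j <;> simp [J_apply, h]

/-- The symbol is real: its conjugate has the coefficients `A (-n) = A n`. -/
theorem ae_map_re_eq (hα : IsBddSymbol α) (h : HasFourierBlocks α A)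
    (hsymm : IsPartiallySymmetric A) :
    ∀ᵐ t ∂(haarAddCircle (T := T)), α t = (realPart (α t)).map (fun x : ℝ => (x : ℂ)) := by
  have hA : ∀ n : ℤ, A (-n) = A n := by
    intro n
    rcases Int.natAbs_eq n with hn | hn <;> rw [hn]
    · exact hsymm _
    · rw [neg_neg]; exact (hsymm _).symm
  have key : ∀ a b, ∀ᵐ t ∂(haarAddCircle (T := T)), star (α t a b) = α t a b := by
    intro a b
    refine ae_eq_of_fourierCoeff_eq (f := fun t => star (α t a b))
      ((hα a b).star.mono_exponent le_top) ((hα a b).mono_exponent le_top) fun n => ?_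
    have e : fourierCoeff (fun t => star (α t a b)) n =
        star (fourierCoeff (fun t => α t a b) (-n)) := by
      simp only [fourierCoeff, Complex.star_def, ← integral_conj]
      congr 1
      ext t
      rw [neg_neg, fourier_neg]
      simp
    rw [e, h, h, hA]
    simp
  filter_upwards [ae_all_iff.2 fun a => ae_all_iff.2 fun b => key a b] with t ht
  ext a b
  exact (Complex.conj_eq_iff_re.1 (ht a b)).symm

theorem ae_isGMatrix (hα : IsBddSymbol α) (h : HasFourierBlocks α A)
    (hchain : IsGChain A) (hsymm : IsPartiallySymmetric A) :
    ∀ᵐ t ∂(haarAddCircle (T := T)), IsGMatrix (realPart (α t)) := by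
  have hmem : ∀ a b, MemLp (fun _ : AddCircle T => ((Complex.I / 2) • J (Fin k) ℂ) a b) ⊤
      (haarAddCircle (T := T)) := fun a b => isBddSymbol_const _ a b
  have hβ : IsBddSymbol fun t => α t + (Complex.I / 2) • J (Fin k) ℂ := fun a b =>
    (hα a b).add (hmem a b)
  have hpos := ae_posSemidef_of_blockToeplitz hβ fun n => by
    have e : blockToeplitz (fun t => α t + (Complex.I / 2) • J (Fin k) ℂ) n =
        ((truncation A n).map (fun x : ℝ => (x : ℂ)) +
          (Complex.I / 2) • J (Fin n × Fin k) ℂ).submatrix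
        (Equiv.prodAssoc _ _ _).symm (Equiv.prodAssoc _ _ _).symm := by
      ext ⟨i, a⟩ ⟨j, b⟩
      have h1 : fourierCoeff (fun _ : AddCircle T => ((Complex.I / 2) • J (Fin k) ℂ) a b)
          ((i : ℤ) - j) = if i = j then ((Complex.I / 2) • J (Fin k) ℂ) a b else 0 := by
        have := fourierCoeff.const_mul (fun _ : AddCircle T => (1 : ℂ))
          (((Complex.I / 2) • J (Fin k) ℂ) a b) ((i : ℤ) - j)
        simp only [mul_one, fourierCoeff_one] at this
        rw [this]
        simp [sub_eq_zero, Fin.val_inj]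
      have h2 := congrFun (fourierCoeff.add ((hα a b).integrable le_top)
        ((hmem a b).integrable le_top)) ((i : ℤ) - j)
      rw [Pi.add_apply, h1, h] at h2
      refine h2.trans ?_
      simp [truncation, J_prod_apply]
    rw [e]
    exact (hchain n).2.submatrix _
  filter_upwards [hpos, ae_map_re_eq hα h hsymm] with t h1 h2
  rw [h2] at h1
  exact isGMatrix_of_posSemidef h1

/-- One constant bounds the squared operator norms of all truncations and of almost all values of
the symbol. -/
theorem exists_mulVec_bound (hα : IsBddSymbol α) (h : HasFourierBlocks α A) :
    ∃ C : ℝ, (∀ (n : ℕ) (x : (Fin n × Fin k) × Fin 2 → ℝ),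
        (truncation A n).mulVec x ⬝ᵥ (truncation A n).mulVec x ≤ C * (x ⬝ᵥ x)) ∧
      ∀ᵐ t ∂(haarAddCircle (T := T)), ∀ x : Fin k × Fin 2 → ℝ,
        (realPart (α t)).mulVec x ⬝ᵥ (realPart (α t)).mulVec x ≤ C * (x ⬝ᵥ x) := by
  obtain ⟨D, -, hD⟩ := exists_sum_sq_blockToeplitz_mulVec_le hα
  choose B hB using fun a b => exists_ae_norm_le (hα a b)
  have hself : ∀ {κ : Type} [Fintype κ] (x : κ → ℝ), 0 ≤ x ⬝ᵥ x := fun x =>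
    Finset.sum_nonneg fun _ _ => mul_self_nonneg _
  refine ⟨max D (∑ a, ∑ b, B a b ^ 2), fun n x => ?_, ?_⟩
  · refine le_trans ?_ (mul_le_mul_of_nonneg_right (le_max_left _ _) (hself x))
    have h1 := hD n fun p => (x ((p.1, p.2.1), p.2.2) : ℂ)
    have h2 : ∀ p, (blockToeplitz α n).mulVec (fun p => (x ((p.1, p.2.1), p.2.2) : ℂ)) p =
        (((truncation A n).mulVec x ((p.1, p.2.1), p.2.2) : ℝ) : ℂ) := by
      intro p
      rw [blockToeplitz_eq_submatrix h]
      simp only [Matrix.mulVec, dotProduct, Complex.ofReal_sum, Complex.ofReal_mul]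
      exact Fintype.sum_equiv (Equiv.prodAssoc _ _ _).symm _ _ fun _ => rfl
    simp only [h2, Complex.norm_real, Real.norm_eq_abs, sq_abs] at h1
    have h3 : ∀ y : (Fin n × Fin k) × Fin 2 → ℝ,
        ∑ p : Fin n × Fin k × Fin 2, y ((p.1, p.2.1), p.2.2) ^ 2 = y ⬝ᵥ y := by
      intro y
      simp only [dotProduct, ← sq]
      exact Fintype.sum_equiv (Equiv.prodAssoc _ _ _).symm _ _ fun _ => rfl
    rwa [h3, h3] at h1
  · filter_upwards [ae_all_iff.2 fun a => ae_all_iff.2 fun b => hB a b] with t ht x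
    refine le_trans ?_ (mul_le_mul_of_nonneg_right (le_max_right _ _) (hself x))
    rw [Finset.sum_mul]
    refine Finset.sum_le_sum fun a _ => ?_
    rw [← sq]
    have hcs := Finset.sum_mul_sq_le_sq_mul_sq Finset.univ (fun b => realPart (α t) a b) x
    refine hcs.trans ?_
    have hx : ∑ b, x b ^ 2 = x ⬝ᵥ x := by simp only [dotProduct, ← sq]
    rw [hx]
    refine mul_le_mul_of_nonneg_right (Finset.sum_le_sum fun b _ => ?_) (hself x)
    rw [← sq_abs]
    exact pow_le_pow_left₀ (abs_nonneg _) ((Complex.abs_re_le_norm _).trans (ht a b)) 2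

theorem trace_map_ofReal_pow {κ : Type*} [Fintype κ] [DecidableEq κ] (X : Matrix κ κ ℝ) (s : ℕ) :
    ((X.map (fun x : ℝ => (x : ℂ))) ^ s).trace = (((X ^ s).trace : ℝ) : ℂ) := by
  have h : (X.map (fun x : ℝ => (x : ℂ))) ^ s = (X ^ s).map (fun x : ℝ => (x : ℂ)) :=
    (map_pow (Complex.ofRealHom.mapMatrix) X s).symm
  rw [h]
  simp [Matrix.trace]

theorem J_mul_map_ofReal {ι : Type*} [Fintype ι] [DecidableEq ι]
    (X : Matrix (ι × Fin 2) (ι × Fin 2) ℝ) :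
    J ι ℂ * X.map (fun x : ℝ => (x : ℂ)) = (J ι ℝ * X).map (fun x : ℝ => (x : ℂ)) := by
  have hJ : J ι ℂ = (J ι ℝ).map (fun x : ℝ => (x : ℂ)) := by
    ext ⟨i, s⟩ ⟨j, t⟩
    by_cases hij : i = j
    · fin_cases s <;> fin_cases t <;> simp [J_apply, hij]
    · simp [J_apply, hij]
  rw [hJ]
  exact (map_mul (Complex.ofRealHom.mapMatrix) (J ι ℝ) X).symm

/-- `T_n(J a) = J T_n(a)` up to the order of the indices, so the powers have equal traces. -/
theorem trace_blockToeplitz_J_mul_pow (hα : IsBddSymbol α) (h : HasFourierBlocks α A) (n s : ℕ) :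
    (blockToeplitz (fun t => J (Fin k) ℂ * α t) n ^ s).trace =
      ((((J (Fin n × Fin k) ℝ * truncation A n) ^ s).trace : ℝ) : ℂ) := by
  have e : blockToeplitz (fun t => J (Fin k) ℂ * α t) n =
      Matrix.reindexAlgEquiv ℂ ℂ (Equiv.prodAssoc _ _ _)
        ((J (Fin n × Fin k) ℝ * truncation A n).map (fun x : ℝ => (x : ℂ))) := by
    rw [← J_mul_map_ofReal]
    ext ⟨i, a⟩ ⟨j, b⟩
    have h1 : fourierCoeff (fun t => (J (Fin k) ℂ * α t) a b) ((i : ℤ) - j) =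
        ∑ c, J (Fin k) ℂ a c * (A ((i : ℤ) - j) c b : ℂ) := by
      simp only [Matrix.mul_apply]
      rw [fourierCoeff_finsetSum _ _ fun c _ => (hα c b).const_mul _]
      exact Finset.sum_congr rfl fun c _ => by rw [fourierCoeff.const_mul, h]
    refine h1.trans ?_
    simp only [Matrix.coe_reindexAlgEquiv, Matrix.reindex_apply, Matrix.submatrix_apply,
      Matrix.mul_apply, Matrix.map_apply, Equiv.prodAssoc_symm_apply]
    symm
    rw [← (Equiv.prodAssoc (Fin n) (Fin k) (Fin 2)).symm.sum_comp, Fintype.sum_prod_type,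
      Finset.sum_eq_single i]
    · refine Finset.sum_congr rfl fun c _ => ?_
      rw [Equiv.prodAssoc_symm_apply, J_prod_apply, if_pos rfl]
      rfl
    · intro l _ hl
      refine Finset.sum_eq_zero fun c _ => ?_
      rw [Equiv.prodAssoc_symm_apply, J_prod_apply, if_neg hl.symm, zero_mul]
    · simp
  rw [e, ← map_pow, ← trace_map_ofReal_pow]
  simp only [Matrix.coe_reindexAlgEquiv, Matrix.trace, Matrix.diag, Matrix.reindex_apply,
    Matrix.submatrix_apply]
  exact (Equiv.prodAssoc _ _ _).symm.sum_comp
    fun p => ((J (Fin n × Fin k) ℝ * truncation A n).map (fun x : ℝ => (x : ℂ)) ^ s) p p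

theorem integrable_trace_J_mul_pow (hα : IsBddSymbol α) (h : HasFourierBlocks α A)
    (hsymm : IsPartiallySymmetric A) (s : ℕ) :
    Integrable (fun t => ((J (Fin k) ℝ * realPart (α t)) ^ s).trace)
        (haarAddCircle (T := T)) ∧
      Tendsto (fun n : ℕ => ((J (Fin n × Fin k) ℝ * truncation A n) ^ s).trace / (n : ℝ)) atTop
        (𝓝 (∫ t, ((J (Fin k) ℝ * realPart (α t)) ^ s).trace ∂haarAddCircle)) := by
  have hγ : IsBddSymbol fun t => J (Fin k) ℂ * α t := (isBddSymbol_const _).mul hα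
  have hae : (fun t => ((J (Fin k) ℂ * α t) ^ s).trace) =ᵐ[haarAddCircle (T := T)]
      fun t => ((((J (Fin k) ℝ * realPart (α t)) ^ s).trace : ℝ) : ℂ) := by
    filter_upwards [ae_map_re_eq hα h hsymm] with t ht
    rw [← trace_map_ofReal_pow, ← J_mul_map_ofReal, ← ht]
  constructor
  · have h1 : Integrable (fun t => ((J (Fin k) ℂ * α t) ^ s).trace) (haarAddCircle (T := T)) :=
      integrable_finsetSum _ fun a _ => ((hγ.pow s) a a).integrable le_top
    have h2 := (h1.congr hae).re
    simpa using h2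
  · have h1 := tendsto_trace_blockToeplitz_pow hγ s
    rw [integral_congr_ae hae, integral_complex_ofReal] at h1
    have h2 := (Complex.continuous_re.tendsto _).comp h1
    rw [Complex.ofReal_re] at h2
    refine h2.congr fun n => ?_
    rw [Function.comp_apply, trace_blockToeplitz_J_mul_pow hα h]
    norm_cast

theorem integrable_polyTrace (hα : IsBddSymbol α) (h : HasFourierBlocks α A)
    (hsymm : IsPartiallySymmetric A) (p : Polynomial ℝ) :
    Integrable (fun t => polyTrace p (realPart (α t))) (haarAddCircle (T := T)) :=
  integrable_finsetSum _ fun r _ =>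
    ((integrable_trace_J_mul_pow hα h hsymm (2 * r)).1.const_mul _).const_mul _

theorem tendsto_polyTrace (hα : IsBddSymbol α) (h : HasFourierBlocks α A)
    (hsymm : IsPartiallySymmetric A) (p : Polynomial ℝ) :
    Tendsto (fun n : ℕ => polyTrace p (truncation A n) / (n : ℝ)) atTop
      (𝓝 (∫ t, polyTrace p (realPart (α t)) ∂haarAddCircle)) := by
  have h1 := tendsto_finsetSum (Finset.range (p.natDegree + 1)) fun r _ =>
    (((integrable_trace_J_mul_pow hα h hsymm (2 * r)).2.const_mul
      ((-1 : ℝ) ^ r / 2)).const_mul (p.coeff r))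
  unfold polyTrace
  rw [integral_finsetSum _ fun r _ =>
    ((integrable_trace_J_mul_pow hα h hsymm (2 * r)).1.const_mul _).const_mul _]
  simp only [integral_const_mul]
  refine h1.congr fun n => ?_
  rw [Finset.sum_div]
  exact Finset.sum_congr rfl fun r _ => by ring

/-- Weierstrass approximation replaces the entropy by polynomial traces, uniformly over the
truncations (per block) and over the values of the symbol. -/
theorem exists_polyTrace_near_entropy (hα : IsBddSymbol α) (h : HasFourierBlocks α A)
    (hchain : IsGChain A) (hsymm : IsPartiallySymmetric A) {ε : ℝ} (hε : 0 < ε) :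
    ∃ p : Polynomial ℝ,
      (∀ n : ℕ, |entropy (truncation A n) / n - polyTrace p (truncation A n) / n| ≤ ε) ∧
      ∀ᵐ t ∂(haarAddCircle (T := T)),
        |entropy (realPart (α t)) - polyTrace p (realPart (α t))| ≤ ε := by
  obtain ⟨C, hC1, hC2⟩ := exists_mulVec_bound hα h
  have hk : (0 : ℝ) < k + 1 := by positivity
  obtain ⟨p, hp⟩ := exists_polynomial_near_of_continuousOn 0 C entropyProfile
    continuous_entropyProfile.continuousOn (ε / (k + 1)) (by positivity)
  have hle : k * (ε / (k + 1)) ≤ ε := by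
    rw [← mul_div_assoc, div_le_iff₀ hk]
    linarith
  refine ⟨p, fun n => ?_, ?_⟩
  · have h1 := abs_entropy_sub_polyTrace_le (hchain n).1 (hC1 n) hp
    rw [Fintype.card_prod, Fintype.card_fin, Fintype.card_fin] at h1
    rw [← sub_div, abs_div, Nat.abs_cast]
    refine div_le_of_le_mul₀ n.cast_nonneg hε.le (h1.trans ?_)
    rw [Nat.cast_mul, mul_assoc, mul_comm]
    exact mul_le_mul_of_nonneg_right hle n.cast_nonneg
  · filter_upwards [hC2, ae_isGMatrix hα h hchain hsymm] with t h1 h2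
    have h3 := abs_entropy_sub_polyTrace_le h2.1 h1 hp
    rw [Fintype.card_fin] at h3
    exact h3.trans hle

/-- Measurability is not clear from the definition of the symplectic eigenvalues by choice; it holds
because the entropy is a uniform limit of polynomial traces. -/
theorem integrable_entropy (hα : IsBddSymbol α) (h : HasFourierBlocks α A)
    (hchain : IsGChain A) (hsymm : IsPartiallySymmetric A) :
    Integrable (fun t => entropy (realPart (α t))) (haarAddCircle (T := T)) := by
  have happrox := fun j : ℕ => exists_polyTrace_near_entropy hα h hchain hsymm
    (Nat.one_div_pos_of_nat (n := j) (α := ℝ))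
  choose p _ hp using happrox
  have hmeas : AEStronglyMeasurable (fun t => entropy (realPart (α t)))
      (haarAddCircle (T := T)) := by
    refine aestronglyMeasurable_of_tendsto_ae atTop
      (f := fun (j : ℕ) t => polyTrace (p j) (realPart (α t)))
      (fun j => (integrable_polyTrace hα h hsymm _).aestronglyMeasurable) ?_
    filter_upwards [ae_all_iff.2 hp] with t ht
    rw [tendsto_iff_dist_tendsto_zero]
    refine squeeze_zero (fun _ => dist_nonneg) (fun j => ?_)
      tendsto_one_div_add_atTop_nhds_zero_nat
    rw [dist_comm, Real.dist_eq]
    exact ht j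
  refine Integrable.mono' ((integrable_polyTrace hα h hsymm (p 0)).abs.add
    (integrable_const (1 / (((0 : ℕ) : ℝ) + 1)))) hmeas ?_
  filter_upwards [hp 0] with t ht
  rw [Pi.add_apply, Real.norm_eq_abs]
  have := abs_sub_abs_le_abs_sub (entropy (realPart (α t))) (polyTrace (p 0) (realPart (α t)))
  linarith

theorem hasEntropyRate_integral (hα : IsBddSymbol α) (h : HasFourierBlocks α A)
    (hchain : IsGChain A) (hsymm : IsPartiallySymmetric A) :
    HasEntropyRate A (∫ t, entropy (realPart (α t)) ∂haarAddCircle) := by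
  unfold HasEntropyRate
  refine tendsto_of_forall_approx fun ε hε => ?_
  obtain ⟨p, hp1, hp2⟩ := exists_polyTrace_near_entropy hα h hchain hsymm hε
  refine ⟨fun n => polyTrace p (truncation A n) / n, _, tendsto_polyTrace hα h hsymm p, hp1, ?_⟩
  rw [← integral_sub (integrable_entropy hα h hchain hsymm) (integrable_polyTrace hα h hsymm p)]
  have hle := norm_integral_le_of_norm_le_const (μ := haarAddCircle (T := T))
    (f := fun t => entropy (realPart (α t)) - polyTrace p (realPart (α t))) (C := ε) hp2
  rwa [probReal_univ, mul_one, Real.norm_eq_abs] at hle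

end Circle

/-! ### Transfer from the circle to the interval -/

section Lift

variable {T : ℝ} [hT : Fact (0 < T)] {β : Type*} {c : ℝ}

theorem ae_of_ae_liftIoc {a : ℝ → β} {P : β → Prop}
    (h : ∀ᵐ t ∂(haarAddCircle (T := T)), P (liftIoc T c a t)) :
    ∀ᵐ θ ∂(volume.restrict (Set.Ioc c (c + T))), P (a θ) := by
  have hvol : ∀ᵐ t : AddCircle T, P (liftIoc T c a t) := by
    rw [volume_eq_smul_haarAddCircle]
    exact Measure.ae_smul_measure h _
  filter_upwards [(AddCircle.measurePreserving_mk T c).quasiMeasurePreserving.ae hvol,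
    ae_restrict_mem measurableSet_Ioc] with θ h1 h2
  rwa [liftIoc_coe_apply h2] at h1

theorem intervalIntegrable_of_integrable_liftIoc {a : ℝ → β} {g : β → ℝ}
    (h : Integrable (fun t => g (liftIoc T c a t)) (haarAddCircle (T := T))) :
    IntervalIntegrable (fun θ => g (a θ)) volume c (c + T) := by
  have hvol : Integrable (fun t : AddCircle T => g (liftIoc T c a t)) volume := by
    rw [volume_eq_smul_haarAddCircle]
    exact h.smul_measure ENNReal.ofReal_ne_top
  rw [intervalIntegrable_iff_integrableOn_Ioc_of_le (by linarith [hT.out])]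
  refine ((AddCircle.measurePreserving_mk T c).integrable_comp_of_integrable hvol).congr ?_
  filter_upwards [ae_restrict_mem measurableSet_Ioc] with θ hθ
  rw [Function.comp_apply, liftIoc_coe_apply hθ]

theorem integral_liftIoc_haarAddCircle {E : Type*} [NormedAddCommGroup E] [NormedSpace ℝ E]
    (a : ℝ → β) (g : β → E) :
    ∫ t, g (liftIoc T c a t) ∂haarAddCircle = T⁻¹ • ∫ θ in c..(c + T), g (a θ) := by
  rw [integral_haarAddCircle]
  congr 1
  exact integral_liftIoc_eq_intervalIntegral (T := T) (f := fun θ => g (a θ))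

end Lift

end GaussianChain

end

theorem corollary4p2 {k : ℕ}
    (A : ℤ → Matrix (Fin k × Fin 2) (Fin k × Fin 2) ℝ)
    (a : ℝ → Matrix (Fin k × Fin 2) (Fin k × Fin 2) ℂ)
    (hgen : GaussianChain.IsGeneratedBy A a)
    (hchain : GaussianChain.IsGChain A)
    (hsymm : GaussianChain.IsPartiallySymmetric A) :
    (∀ᵐ θ ∂(volume.restrict (Set.Icc (-Real.pi) Real.pi)),
      a θ = (GaussianChain.realPart (a θ)).map (fun x : ℝ => (x : ℂ)) ∧
        GaussianChain.IsGMatrix (GaussianChain.realPart (a θ))) ∧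
    IntervalIntegrable (fun θ => GaussianChain.entropy (GaussianChain.realPart (a θ)))
      volume (-Real.pi) Real.pi ∧
    GaussianChain.HasEntropyRate A
      (1 / (2 * Real.pi) *
        ∫ θ in (-Real.pi)..Real.pi,
          GaussianChain.entropy (GaussianChain.realPart (a θ))) := by
  obtain ⟨hbdd, hcoef⟩ := hgen
  have : Fact (0 < 2 * Real.pi) := ⟨Real.two_pi_pos⟩
  have hend : -Real.pi + 2 * Real.pi = Real.pi := by ring
  have hIoc : volume.restrict (Set.Icc (-Real.pi) Real.pi) =
      volume.restrict (Set.Ioc (-Real.pi) (-Real.pi + 2 * Real.pi)) := by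
    rw [hend]
    exact (Measure.restrict_congr_set Ioc_ae_eq_Icc).symm
  set α : AddCircle (2 * Real.pi) → Matrix (Fin k × Fin 2) (Fin k × Fin 2) ℂ :=
    AddCircle.liftIoc (2 * Real.pi) (-Real.pi) a with hα
  have hbddα : GaussianChain.IsBddSymbol α := by
    intro i j
    have h := hbdd i j
    rw [hIoc] at h
    exact h.memLp_liftIoc.haarAddCircle
  have hblocks : GaussianChain.HasFourierBlocks α A := by
    intro n i j
    have h := congrFun (congrFun (hcoef n) i) j
    rw [Matrix.map_apply] at h
    rw [← h]
    have h1 : fourierCoeff (fun t => α t i j) n =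
        fourierCoeff (AddCircle.liftIoc (2 * Real.pi) (-Real.pi) fun θ => a θ i j) n := rfl
    rw [h1, fourierCoeff_liftIoc_eq, fourierCoeffOn_eq_integral]
    simp only [GaussianChain.fourierBlock, Matrix.of_apply]
    rw [hend, sub_neg_eq_add, ← two_mul, Complex.real_smul]
    congr 1
    · push_cast
      rfl
    · refine intervalIntegral.integral_congr fun θ _ => ?_
      simp only [smul_eq_mul]
      rw [mul_comm, fourier_coe_apply]
      congr 2
      have : (Real.pi : ℂ) ≠ 0 := by exact_mod_cast Real.pi_ne_zero
      push_cast
      field_simp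
  refine ⟨?_, ?_, ?_⟩
  · rw [hIoc]
    exact GaussianChain.ae_of_ae_liftIoc (T := 2 * Real.pi)
      (P := fun M => M = (GaussianChain.realPart M).map (fun x : ℝ => (x : ℂ)) ∧
        GaussianChain.IsGMatrix (GaussianChain.realPart M))
      ((GaussianChain.ae_map_re_eq hbddα hblocks hsymm).and
        (GaussianChain.ae_isGMatrix hbddα hblocks hchain hsymm))
  · have h := GaussianChain.intervalIntegrable_of_integrable_liftIoc
      (g := fun M => GaussianChain.entropy (GaussianChain.realPart M))
      (GaussianChain.integrable_entropy hbddα hblocks hchain hsymm)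
    rwa [hend] at h
  · have h := GaussianChain.hasEntropyRate_integral hbddα hblocks hchain hsymm
    rw [hα, GaussianChain.integral_liftIoc_haarAddCircle a
      (fun M => GaussianChain.entropy (GaussianChain.realPart M)), hend, smul_eq_mul] at h
    rwa [one_div]
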